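/- Let $k\ge 0$ and $r\ge 1$ be integers. A variety is a reduced separated scheme of finite type over $\mathbb{C}$ (not necessarily irreducible). Let $((\mathbb{C}^r)^k)^\circ\subset(\mathbb{C}^r)^k$ be the open subvariety of tuples $(m_1,\dots,m_k)$ of vectors $m_j\in\mathbb{C}^r$ such that $\sum_{j\in S}m_j\neq 0$ for every nonempty $S\subseteq\{1,\dots,k\}$. For an affine variety $X$ and $d\ge 0$ put $\mathrm{Sym}^dX=X^d/S_d=\operatorname{Spec}\big(\Gamma(X^d)^{S_d}\big)$. For $P=(m_1,\dots,m_k)\in(\mathbb{Z}_{\ge 0}^r\setminus\{0\})^k$ put $d_i=\sum_{j}(m_j)_i$; the ($r$-colored) incidence stratum $\Delta^{k,r}_P(X)\subset\prod_{i=1}^r\mathrm{Sym}^{d_i}X$ is the image, as a reduced closed subscheme, of the morphism $X^k\to\prod_{i=1}^r\mathrm{Sym}^{d_i}X$ that sends $(x_1,\dots,x_k)$ to the configuration in which $x_j$ occurs $(m_j)_i$ times among the points of color $i$, for all $i$ and $j$. There are a functor $X\mapsto\Delta^{k,r}(X)$ from affine varieties to varieties over $((\mathbb{C}^r)^k)^\circ$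 and a morphism $$q_X:((\mathbb{C}^r)^k)^\circ\times X^k\to\Delta^{k,r}(X)$$ over $((\mathbb{C}^r)^k)^\circ$, natural in $X$, such that: 1. for every affine variety $X$, the structure morphism $\Delta^{k,r}(X)\to((\mathbb{C}^r)^k)^\circ$ is affine (so $\Delta^{k,r}(X)$ is an affine variety if $r=1$), $q_X$ is finite and surjective, and $\Delta^{k,r}(X)$ is irreducible if $X$ is; 2. for every $P=(m_1,\dots,m_k)\in(\mathbb{Z}_{\ge 0}^r\setminus\{0\})^k\subset((\mathbb{C}^r)^k)^\circ$, the reduced fiber of $\Delta^{k,r}(X)$ over $P$ is isomorphic over $\mathbb{C}$, naturally in $X$, to the incidence stratum $\Delta^{k,r}_P(X)$, and this isomorphism identifies the morphism from $X^k$ to the reduced fiber induced by $q_X$ with the morphism $X^k\to\Delta^{k,r}_P(X)$ above. For $r=1$ this says that the incidence strata $\Delta^k_{(m_1,\dots,m_k)}(X)\subset\mathrm{Sym}^{m_1+\dots+m_k}X$ with positive integers $m_j$ are the reduced fibers of a family of affine varieties $\Delta^k(X)$ over $(\mathbb{C}^k)^\circ$ that is functorial in $X$. -/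

import Mathlib

open CategoryTheory CategoryTheory.Limits AlgebraicGeometry

noncomputable section

namespace IncidenceStrata

/-! ### Varieties over the complex numbers -/

/-- The base scheme `Spec ℂ`. -/
abbrev SpecC : Scheme.{0} := Spec (CommRingCat.of ℂ)

/-- A variety: a reduced separated scheme of finite type over `ℂ` (not necessarily irreducible). -/
structure IsVariety (X : Over SpecC) : Prop where
  isReduced : IsReduced X.left
  isSeparated : IsSeparated X.hom
  locallyOfFiniteType : LocallyOfFiniteType X.hom
  quasiCompact : QuasiCompact X.hom

/-- The category of affine varieties over `ℂ`, with all morphisms of `ℂ`-schemes. -/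
abbrev AffVar : Type 1 :=
  ObjectProperty.FullSubcategory (fun X : Over SpecC => IsVariety X ∧ IsAffine X.left)

/-! ### Cartesian and symmetric powers -/

/-- The cartesian power `X ↦ Xⁿ` (product over `Spec ℂ`). -/
def pow (n : ℕ) : AffVar ⥤ Over SpecC where
  obj X := ∏ᶜ fun _ : Fin n => X.obj
  map φ := Limits.Pi.map fun _ => φ.hom

/-- The morphism `(x_1, …, x_k) ↦ (x_{σ(1)}, …, x_{σ(n)})` from `X^k` to `X^n`. -/
def reindex {k n : ℕ} (σ : Fin n → Fin k) : pow k ⟶ pow n where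
  app X := Limits.Pi.lift fun t => Limits.Pi.π (fun _ : Fin k => X.obj) (σ t)
  naturality X Y φ := by
    refine Limits.Pi.hom_ext _ _ fun t => ?_
    simp [pow]

/-- Pullback of regular functions along a morphism of `ℂ`-schemes. -/
abbrev pullbackFun {Y Z : Over SpecC} (f : Y ⟶ Z) : Γ(Z.left, ⊤) →+* Γ(Y.left, ⊤) :=
  f.left.appTop.hom

/-- The ring `Γ(Xⁿ)^{S_n}` of regular functions on `Xⁿ` that are invariant under all
permutations of the factors. -/
def invariants (n : ℕ) (X : AffVar) : Subring Γ(((pow n).obj X).left, ⊤) :=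
  ⨅ σ : Equiv.Perm (Fin n), RingHom.eqLocus (pullbackFun ((reindex σ).app X)) (RingHom.id _)

theorem mem_invariants {n : ℕ} {X : AffVar} {s : Γ(((pow n).obj X).left, ⊤)} :
    s ∈ invariants n X ↔
      ∀ σ : Equiv.Perm (Fin n), pullbackFun ((reindex σ).app X) s = s := by
  simp [invariants, Subring.mem_iInf]

theorem pullbackFun_comp {Y Z W : Over SpecC} (f : Y ⟶ Z) (g : Z ⟶ W) (s : Γ(W.left, ⊤)) :
    pullbackFun (f ≫ g) s = pullbackFun f (pullbackFun g s) := by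
  change _ = ((g.left.appTop ≫ f.left.appTop).hom) s
  rw [← Scheme.Hom.comp_appTop]
  rfl

/-- The constants `ℂ → Γ(Y)`. -/
def constants (Y : Over SpecC) : ℂ →+* Γ(Y.left, ⊤) :=
  ((Scheme.ΓSpecIso (CommRingCat.of ℂ)).inv ≫ Y.hom.appTop).hom

theorem pullbackFun_constants {Y Z : Over SpecC} (f : Y ⟶ Z) (c : ℂ) :
    pullbackFun f (constants Z c) = constants Y c := by
  have h : f.left ≫ Z.hom = Y.hom := Over.w f
  change (((Scheme.ΓSpecIso (CommRingCat.of ℂ)).inv ≫ Z.hom.appTop) ≫ f.left.appTop).hom c = _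
  rw [Category.assoc, ← Scheme.Hom.comp_appTop, h]
  rfl

/-- The constants `ℂ → Γ(Xⁿ)^{S_n}`. -/
def constantsInv (n : ℕ) (X : AffVar) : ℂ →+* invariants n X :=
  (constants ((pow n).obj X)).codRestrict (invariants n X) fun c =>
    mem_invariants.2 fun _ => pullbackFun_constants _ c

/-- Pullback of invariant functions along `φⁿ : Xⁿ → Yⁿ`. -/
def invariantsMap (n : ℕ) {X Y : AffVar} (φ : X ⟶ Y) : invariants n Y →+* invariants n X :=
  (pullbackFun ((pow n).map φ)).restrict (invariants n Y) (invariants n X) fun s hs =>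
    mem_invariants.2 fun σ => by
      rw [← pullbackFun_comp, ← (reindex σ).naturality φ, pullbackFun_comp,
        mem_invariants.1 hs σ]

/-- The symmetric power `Symⁿ X = Xⁿ / S_n = Spec (Γ(Xⁿ)^{S_n})` of an affine variety. -/
def sym (n : ℕ) : AffVar ⥤ Over SpecC where
  obj X := Over.mk (Spec.map (CommRingCat.ofHom (constantsInv n X)))
  map {X Y} φ := Over.homMk (Spec.map (CommRingCat.ofHom (invariantsMap n φ))) (by
    change Spec.map _ ≫ Spec.map _ = Spec.map _
    rw [← Spec.map_comp, ← CommRingCat.ofHom_comp]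
    congr 2
    ext c
    exact pullbackFun_constants ((pow n).map φ) c)
  map_id X := by
    ext1
    change Spec.map _ = 𝟙 _
    rw [← Spec.map_id, ← CommRingCat.ofHom_id]
    congr 2
    ext s
    change pullbackFun ((pow n).map (𝟙 X)) s.1 = s.1
    rw [CategoryTheory.Functor.map_id]
    simp [pullbackFun]
  map_comp {X Y Z} φ ψ := by
    ext1
    change Spec.map _ = Spec.map _ ≫ Spec.map _
    rw [← Spec.map_comp, ← CommRingCat.ofHom_comp]
    congr 2
    ext s
    change pullbackFun ((pow n).map (φ ≫ ψ)) s.1 = pullbackFun _ (pullbackFun _ s.1)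
    rw [Functor.map_comp, pullbackFun_comp]

/-- The quotient morphism `Xⁿ → Symⁿ X`. -/
def symQuot (n : ℕ) : pow n ⟶ sym n where
  app X := Over.homMk (((pow n).obj X).left.toSpecΓ ≫
      Spec.map (CommRingCat.ofHom (invariants n X).subtype)) (by
    change (_ ≫ Spec.map _) ≫ Spec.map _ = _
    have h : CommRingCat.ofHom (constantsInv n X) ≫ CommRingCat.ofHom (invariants n X).subtype =
        (Scheme.ΓSpecIso (CommRingCat.of ℂ)).inv ≫ ((pow n).obj X).hom.appTop := rfl
    rw [Category.assoc, ← Spec.map_comp, h, Spec.map_comp, ← Scheme.toSpecΓ_naturality_assoc]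
    simp)
  naturality X Y φ := by
    ext1
    change ((pow n).map φ).left ≫ (_ ≫ Spec.map _) = (_ ≫ Spec.map _) ≫ Spec.map _
    have h : CommRingCat.ofHom (invariantsMap n φ) ≫ CommRingCat.ofHom (invariants n X).subtype =
        CommRingCat.ofHom (invariants n Y).subtype ≫ ((pow n).map φ).left.appTop := rfl
    rw [Category.assoc, ← Spec.map_comp, h, Spec.map_comp, ← Scheme.toSpecΓ_naturality_assoc]

/-! ### Incidence strata with integral weights -/

/-- The functor `X ↦ Sym^{d_1} X × ⋯ × Sym^{d_r} X`. -/
def symProd {r : ℕ} (d : Fin r → ℕ) : AffVar ⥤ Over SpecC where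
  obj X := ∏ᶜ fun i => (sym (d i)).obj X
  map φ := Limits.Pi.map fun i => (sym (d i)).map φ

/-- The morphism `X^k → ∏_i Sym^{(m_1)_i + ⋯ + (m_k)_i} X` that sends `(x_1, …, x_k)` to the
configuration in which, for each color `i`, the point `x_j` is repeated `(m_j)_i` times. -/
def incidenceMap {k r : ℕ} (m : Fin k → Fin r → ℕ) :
    pow k ⟶ symProd (fun i => ∑ j, m j i) where
  app X := Limits.Pi.lift fun i =>
    (reindex fun t => (finSigmaFinEquiv (n := fun j => m j i)).symm t |>.1).app X ≫
      (symQuot (∑ j, m j i)).app X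
  naturality X Y φ := by
    refine Limits.Pi.hom_ext _ _ fun i => ?_
    simp [symProd]

/-- A commutative square maps the scheme-theoretic image of `f` to that of `f'`. -/
theorem ker_le_map_ker {X X' Y Y' : Scheme.{0}} {f : X ⟶ Y} {f' : X' ⟶ Y'} {a : X ⟶ X'}
    {b : Y ⟶ Y'} (h : f ≫ b = a ≫ f') : f'.ker ≤ f.ker.map b := by
  rw [Scheme.IdealSheafData.map_ker, h]
  exact Scheme.Hom.le_ker_comp a f'

theorem subschemeMap_eq_id {Y : Scheme.{0}} (I : Y.IdealSheafData) {f : Y ⟶ Y} (hf : f = 𝟙 Y)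
    (H : I ≤ I.map f) : Scheme.IdealSheafData.subschemeMap I I f H = 𝟙 I.subscheme := by
  subst hf
  simp [← cancel_mono I.subschemeι]

theorem subschemeMap_eq_comp {Y Z W : Scheme.{0}} (I : Y.IdealSheafData) (J : Z.IdealSheafData)
    (K : W.IdealSheafData) {f : Y ⟶ Z} {g : Z ⟶ W} {h : Y ⟶ W} (e : h = f ≫ g)
    (H₁ : J ≤ I.map f) (H₂ : K ≤ J.map g) (H₃ : K ≤ I.map h) :
    Scheme.IdealSheafData.subschemeMap I K h H₃ =
      Scheme.IdealSheafData.subschemeMap I J f H₁ ≫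
        Scheme.IdealSheafData.subschemeMap J K g H₂ := by
  subst e
  simp [← cancel_mono K.subschemeι]

theorem toImage_subschemeMap {X X' Y Y' : Scheme.{0}} {f : X ⟶ Y} {f' : X' ⟶ Y'} {a : X ⟶ X'}
    {b : Y ⟶ Y'} (h : f ≫ b = a ≫ f') (H : f'.ker ≤ f.ker.map b) :
    a ≫ f'.toImage = f.toImage ≫ Scheme.IdealSheafData.subschemeMap f.ker f'.ker b H := by
  rw [← cancel_mono f'.imageι]
  simp [← h]

theorem subschemeMap_over {Y Z S : Scheme.{0}} (I : Y.IdealSheafData) (J : Z.IdealSheafData)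
    {f : Y ⟶ Z} (H : J ≤ I.map f) {y : Y ⟶ S} {z : Z ⟶ S} (h : f ≫ z = y) :
    Scheme.IdealSheafData.subschemeMap I J f H ≫ (J.subschemeι ≫ z) = I.subschemeι ≫ y := by
  simp [← h]

theorem imageFunctor_aux {F G : AffVar ⥤ Over SpecC} (α : F ⟶ G) {X Y : AffVar} (φ : X ⟶ Y) :
    (α.app Y).left.ker ≤ (α.app X).left.ker.map (G.map φ).left :=
  ker_le_map_ker (congrArg Over.Hom.left (α.naturality φ).symm)

/-- The functor that sends `X` to the scheme-theoretic image of `α_X : F(X) → G(X)`, a closed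
subscheme of `G(X)`. -/
def imageFunctor {F G : AffVar ⥤ Over SpecC} (α : F ⟶ G) : AffVar ⥤ Over SpecC where
  obj X := Over.mk ((α.app X).left.imageι ≫ (G.obj X).hom)
  map {X Y} φ := Over.homMk (Scheme.IdealSheafData.subschemeMap _ _ (G.map φ).left
    (imageFunctor_aux α φ)) (subschemeMap_over _ _ _ (Over.w (G.map φ)))
  map_id X := by
    ext1
    exact subschemeMap_eq_id _ (by simp) (imageFunctor_aux α _)
  map_comp φ ψ := by
    ext1
    exact subschemeMap_eq_comp _ _ _ (by simp) (imageFunctor_aux α _) (imageFunctor_aux α _)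
      (imageFunctor_aux α _)

/-- The morphism `F(X) → im α_X` induced by `α_X`. -/
def toImageFunctor {F G : AffVar ⥤ Over SpecC} (α : F ⟶ G) : F ⟶ imageFunctor α where
  app X := Over.homMk (α.app X).left.toImage
    ((Scheme.Hom.toImage_imageι_assoc (α.app X).left (G.obj X).hom).trans (Over.w (α.app X)))
  naturality X Y φ := by
    ext1
    exact toImage_subschemeMap (congrArg Over.Hom.left (α.naturality φ).symm)
      (imageFunctor_aux α φ)

/-- The (closed) `r`-colored incidence stratum with weights `m_1, …, m_k ∈ ℕ^r`: the image of
the morphism `incidenceMap m : X^k → ∏_i Sym^{d_i} X`, as a closed subscheme of the target.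
It is reduced because `X^k` is. -/
def stratum {k r : ℕ} (m : Fin k → Fin r → ℕ) : AffVar ⥤ Over SpecC :=
  imageFunctor (incidenceMap m)

/-- The surjection from `X^k` to the incidence stratum induced by `incidenceMap m`. -/
def toStratum {k r : ℕ} (m : Fin k → Fin r → ℕ) : pow k ⟶ stratum m :=
  toImageFunctor (incidenceMap m)

/-! ### Reduction of schemes -/

theorem nilradical_le_map {Y Z : Scheme.{0}} (f : Y ⟶ Z) :
    Z.nilradical ≤ Y.nilradical.map f := by
  rw [Scheme.nilradical, Scheme.nilradical, ← Scheme.IdealSheafData.vanishingIdeal_support,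
    ← Scheme.IdealSheafData.vanishingIdeal_support, Scheme.IdealSheafData.map_vanishingIdeal]
  exact Scheme.IdealSheafData.vanishingIdeal_antimono (by simp)

/-- The functor `Y ↦ Y_red` on schemes over `S`. -/
def reduction (S : Scheme.{0}) : Over S ⥤ Over S where
  obj Y := Over.mk (Y.left.nilradical.subschemeι ≫ Y.hom)
  map {Y Z} f := Over.homMk (Scheme.IdealSheafData.subschemeMap _ _ f.left
    (nilradical_le_map f.left)) (subschemeMap_over _ _ _ (Over.w f))
  map_id Y := by
    ext1
    exact subschemeMap_eq_id _ rfl (nilradical_le_map _)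
  map_comp f g := by
    ext1
    exact subschemeMap_eq_comp _ _ _ rfl (nilradical_le_map _) (nilradical_le_map _)
      (nilradical_le_map _)

/-- The closed immersion `Y_red → Y`. -/
def reductionι {S : Scheme.{0}} (Y : Over S) : (reduction S).obj Y ⟶ Y :=
  Over.homMk Y.left.nilradical.subschemeι rfl

/-! ### The space of weights -/

/-- The open subset of the affine space `Spec ℂ[m_{j,i}]` of tuples of weights where, for each
nonempty set `S` of indices, the vector `∑_{j ∈ S} m_j` is nonzero, that is, one of
its coordinates is nonzero. -/
def weightOpen (k r : ℕ) :
    (Spec (CommRingCat.of (MvPolynomial (Fin k × Fin r) ℂ))).Opens :=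
  ⨅ S : {S : Finset (Fin k) // S.Nonempty}, ⨆ i : Fin r,
    PrimeSpectrum.basicOpen (∑ j ∈ S.1, MvPolynomial.X (j, i))

/-- The space of weights `((ℂ^r)^k)°`, as a scheme over `ℂ`. -/
def weightSpace (k r : ℕ) : Over SpecC :=
  Over.mk ((weightOpen k r).ι ≫ Spec.map (CommRingCat.ofHom MvPolynomial.C))

/-- The closed point of the affine space of all tuples of weights given by `w`. -/
def affinePoint {k r : ℕ} (w : Fin k → Fin r → ℂ) :
    SpecC ⟶ Spec (CommRingCat.of (MvPolynomial (Fin k × Fin r) ℂ)) :=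
  Spec.map (CommRingCat.ofHom (MvPolynomial.eval fun p : Fin k × Fin r => w p.1 p.2))

theorem range_affinePoint {k r : ℕ} (w : Fin k → Fin r → ℂ)
    (hw : ∀ S : Finset (Fin k), S.Nonempty → ∑ j ∈ S, w j ≠ 0) :
    Set.range (affinePoint w) ⊆ Set.range (weightOpen k r).ι := by
  rintro _ ⟨x, rfl⟩
  rw [Scheme.Opens.range_ι]
  change _ ∈ weightOpen k r
  rw [weightOpen, ← SetLike.mem_coe, TopologicalSpace.Opens.coe_iInf, Set.mem_iInter]
  rintro ⟨S, hS⟩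
  obtain ⟨i, hi⟩ := Function.ne_iff.1 (hw S hS)
  refine TopologicalSpace.Opens.mem_iSup.2
    ⟨i, fun hx => x.2.ne_top (Ideal.eq_top_of_isUnit_mem _ hx (IsUnit.mk0 _ ?_))⟩
  simpa using hi

/-- The `ℂ`-point of `((ℂ^r)^k)°` given by a tuple `w` of weight vectors no nonempty
subfamily of which sums to zero. -/
def weightPoint {k r : ℕ} (w : Fin k → Fin r → ℂ)
    (hw : ∀ S : Finset (Fin k), S.Nonempty → ∑ j ∈ S, w j ≠ 0) :
    SpecC ⟶ (weightSpace k r).left :=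
  show SpecC ⟶ (weightOpen k r).toScheme from IsOpenImmersion.lift (weightOpen k r).ι (affinePoint w) (range_affinePoint w hw)

theorem weightPoint_hom {k r : ℕ} (w : Fin k → Fin r → ℂ)
    (hw : ∀ S : Finset (Fin k), S.Nonempty → ∑ j ∈ S, w j ≠ 0) :
    weightPoint w hw ≫ (weightSpace k r).hom = 𝟙 SpecC := by
  change IsOpenImmersion.lift (weightOpen k r).ι (affinePoint w) (range_affinePoint w hw) ≫
    ((weightOpen k r).ι ≫ Spec.map _) = _
  rw [IsOpenImmersion.lift_fac_assoc, affinePoint, ← Spec.map_comp, ← CommRingCat.ofHom_comp,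
    ← Spec.map_id, ← CommRingCat.ofHom_id]
  congr 2
  ext c
  simp

theorem natWeights_sum_ne_zero {k r : ℕ} (m : Fin k → Fin r → ℕ) (hm : ∀ j, m j ≠ 0)
    (S : Finset (Fin k)) (hS : S.Nonempty) :
    ∑ j ∈ S, (fun i => (m j i : ℂ)) ≠ 0 := by
  intro h
  obtain ⟨j, hj⟩ := hS
  refine hm j (funext fun i => ?_)
  have hi := congrFun h i
  rw [Finset.sum_apply, Pi.zero_apply, ← Nat.cast_sum, Nat.cast_eq_zero,
    Finset.sum_eq_zero_iff] at hi
  exact hi j hj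

/-- The `ℂ`-point of `((ℂ^r)^k)°` given by nonzero weight vectors `m_1, …, m_k ∈ ℕ^r`. -/
def natPoint {k r : ℕ} (m : Fin k → Fin r → ℕ) (hm : ∀ j, m j ≠ 0) :
    SpecC ⟶ (weightSpace k r).left :=
  weightPoint (fun j i => (m j i : ℂ)) (natWeights_sum_ne_zero m hm)

/-! ### Families over the space of weights -/

/-- The functor `X ↦ ((ℂ^r)^k)° × X^k` to schemes over `((ℂ^r)^k)°`. -/
def weightedPow (k r : ℕ) : AffVar ⥤ Over (weightSpace k r).left :=
  pow k ⋙ Over.pullback (weightSpace k r).hom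

/-- The reduced fiber at a `ℂ`-point `p` of a scheme over `B`, as a functor. -/
def reducedFiber {B : Scheme.{0}} (p : SpecC ⟶ B) : Over B ⥤ Over SpecC :=
  Over.pullback p ⋙ reduction SpecC

/-- The identification `x ↦ (w, x)` of `X^k` with the fiber of `((ℂ^r)^k)° × X^k` at `w`. -/
def toFiber {k r : ℕ} (w : Fin k → Fin r → ℂ)
    (hw : ∀ S : Finset (Fin k), S.Nonempty → ∑ j ∈ S, w j ≠ 0) (X : AffVar) :
    (pow k).obj X ⟶ (Over.pullback (weightPoint w hw)).obj ((weightedPow k r).obj X) :=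
  Over.homMk
    (pullback.lift
      (pullback.lift (𝟙 _) (((pow k).obj X).hom ≫ weightPoint w hw)
        (by rw [Category.assoc, weightPoint_hom]; simp))
      ((pow k).obj X).hom (pullback.lift_snd _ _ _))
    (pullback.lift_snd _ _ _)

end IncidenceStrata

end

open IncidenceStrata

/-!
# Families of incidence strata

For an affine variety `X`, let `R(X)` be the ring of functions on `X^k × Spec ℂ[m_{j,i}]` generated
by the polynomials in the weights and the weighted sums `∑ j, m_{j,i} f(x_j)`, for all functions `f`
on `X` and all colors `i`. The family `Δ^{k,r}(X)` is the restriction of `Spec R(X)` to the open set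
of admissible weights, and `q` is induced by the inclusion of `R(X)`. Both are functorial because
pullback along a morphism maps weighted sums to weighted sums.

*Finiteness.* The weighted sums of the powers of `f` are the weighted power sums of the elements
`f(x_1), …, f(x_k)`. In a domain over which no nonempty subfamily of the weights sums to zero, they
vanish only if all `f(x_j)` do (`eq_zero_of_weighted_sums_eq_zero`, a Vandermonde argument), so the
ideal that they generate in the polynomial ring contains powers of all variables, and the `f(x_j)`
are integral over `R(X)` locally over admissible weights (`isIntegral_of_weighted_psums_mem`).
Hence `q` is finite, it is surjective because it is injective on functions, and `Δ^{k,r}(X)` is of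
finite type by the Artin-Tate lemma (`finite_awayMap`, `finiteType_away`). Irreducibility passes
from `X` to `X^k` and its product with the space of weights (`isIntegral_pullback`), and from there
to the image.

*Fibers.* The fiber at integral weights `m` receives a surjection from `X^k`, so its reduction is
determined by the ring of functions on `X^k` that extend to it. This ring is generated by the
constants and the sums `∑ j, (m_j)_i f(x_j)` (`range_fiberQuot`). Since the invariants of the
symmetric group are generated by power sums `∑ t, f(x_t)` (`mem_of_perm_invariant`), the
functions that extend to the incidence stratum form the same ring (`range_incidenceMap`). Both
schemes are affine, so they are isomorphic under `X^k`, and the isomorphism is natural because it is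
unique (`exists_iso_of_range_eq`).
-/

noncomputable section

namespace IncidenceStrata

/-! ### Invariants of the symmetric group and power sums -/

section Powersums

variable {A E : Type*} [CommRing A] [CommRing E]

/-- A subring that contains the power sums `∑ t, ι t a` contains the sum of `∏ s, ι (τ s) (a s)`
over all injective `τ : Fin m → Fin n`. By induction on `m`: extend an injective tuple by one
entry with an arbitrary value, and subtract the terms where that value is already taken, in which
two factors merge into one. -/
theorem sum_injective_prod_mem {n : ℕ} (ι : Fin n → A →+* E) (P : Subring E)
    (hP : ∀ a, ∑ t, ι t a ∈ P) (m : ℕ) (a : Fin m → A) :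
    ∑ τ : Fin m → Fin n with Function.Injective τ, ∏ s, ι (τ s) (a s) ∈ P := by
  classical
  induction m with
  | zero =>
    simp [Function.injective_of_subsingleton, P.one_mem]
  | succ m ih =>
    have key : ∑ τ : Fin (m + 1) → Fin n with Function.Injective τ, ∏ s, ι (τ s) (a s) =
        (∑ t, ι t (a 0)) *
            (∑ τ : Fin m → Fin n with Function.Injective τ, ∏ s, ι (τ s) (a s.succ)) -
          ∑ u : Fin m, ∑ τ : Fin m → Fin n with Function.Injective τ,
            ∏ s, ι (τ s) (Function.update (fun s => a s.succ) u (a 0 * a u.succ) s) := by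
      have h1 : ∀ (τ : Fin m → Fin n) (u : Fin m),
          ∏ s, ι (τ s) (Function.update (fun s => a s.succ) u (a 0 * a u.succ) s) =
            ι (τ u) (a 0) * ∏ s, ι (τ s) (a s.succ) := by
        intro τ u
        rw [← Finset.mul_prod_erase _ _ (Finset.mem_univ u),
          ← Finset.mul_prod_erase _ (fun s => ι (τ s) (a s.succ)) (Finset.mem_univ u)]
        rw [Function.update_self, map_mul, mul_assoc]
        congr 2
        refine Finset.prod_congr rfl fun s hs => ?_
        rw [Function.update_of_ne (Finset.ne_of_mem_erase hs)]
      simp_rw [h1]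
      rw [Finset.sum_comm, Finset.mul_sum, ← Finset.sum_sub_distrib]
      rw [Finset.sum_filter, ← (Fin.consEquiv fun _ : Fin (m + 1) => Fin n).sum_comp,
        Fintype.sum_prod_type_right, Finset.sum_filter]
      refine Finset.sum_congr rfl fun τ _ => ?_
      have hcons : ∀ v, Function.Injective ((Fin.consEquiv fun _ : Fin (m + 1) => Fin n) (v, τ)) ↔
          v ∉ Set.range τ ∧ Function.Injective τ := fun v => Fin.cons_injective_iff
      simp only [Fin.consEquiv_apply, Fin.prod_univ_succ, Fin.cons_zero, Fin.cons_succ]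
      simp only [hcons]
      split_ifs with hτ
      · simp only [hτ, and_true]
        rw [← Finset.sum_mul, ← sub_mul, Finset.sum_ite, Finset.sum_const_zero, add_zero,
          ← Finset.sum_mul]
        congr 1
        rw [eq_sub_iff_add_eq, ← Finset.sum_image (f := fun v => ι v (a 0)) (s := Finset.univ)
          (g := τ) hτ.injOn, ← Finset.sum_filter_add_sum_filter_not Finset.univ
          (fun v => v ∉ Set.range τ)]
        congr 2
        ext v
        simp
      · simp [hτ]
    rw [key]
    exact P.sub_mem (P.mul_mem (hP _) (ih _)) (P.sum_mem fun u _ => ih _)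

/-- Let `E` be generated by a subring `C` and by `n` images of a ring `A`, and let the symmetric
group fix `C` and permute these images. Then the invariants lie in every subring that contains
`C`, `ℚ`, and the power sums `∑ t, ι t a`: the orbit sum of `c * ∏ t, ι t (a t)` is `c` times a sum
over injective tuples, and an invariant is its own average. -/
theorem mem_of_perm_invariant [Algebra ℚ E] {n : ℕ} (ι : Fin n → A →+* E)
    (C P : Subring E) (hC : C ≤ P) (hQ : ∀ q : ℚ, algebraMap ℚ E q ∈ P)
    (hP : ∀ a, ∑ t, ι t a ∈ P)
    (hgen : Subring.closure ((C : Set E) ∪ ⋃ t, Set.range (ι t)) = ⊤)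
    (ρ : Equiv.Perm (Fin n) → E →+* E) (hρC : ∀ σ, ∀ c ∈ C, ρ σ c = c)
    (hρ : ∀ σ t a, ρ σ (ι t a) = ι (σ t) a)
    (s : E) (hs : ∀ σ, ρ σ s = s) : s ∈ P := by
  classical
  have hsym : ∀ x : E, ∑ σ, ρ σ x ∈ P := by
    have hspan : ∀ x : E, x ∈ AddSubmonoid.closure
        {y | ∃ c ∈ C, ∃ a : Fin n → A, y = c * ∏ t, ι t (a t)} := by
      let M : Submonoid E :=
        { carrier := {y | ∃ c ∈ C, ∃ a : Fin n → A, y = c * ∏ t, ι t (a t)}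
          one_mem' := ⟨1, C.one_mem, 1, by simp⟩
          mul_mem' := by
            rintro _ _ ⟨c, hc, a, rfl⟩ ⟨d, hd, b, rfl⟩
            refine ⟨c * d, C.mul_mem hc hd, a * b, ?_⟩
            simp only [Pi.mul_apply, map_mul, Finset.prod_mul_distrib]
            ring }
      intro x
      have hx : x ∈ Subring.closure ((C : Set E) ∪ ⋃ t, Set.range (ι t)) := hgen ▸ trivial
      have hM : (C : Set E) ∪ ⋃ t, Set.range (ι t) ⊆ (M : Set E) := by
        rintro y (hy | hy)
        · exact ⟨y, hy, 1, by simp⟩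
        · obtain ⟨t, a, rfl⟩ := Set.mem_iUnion.1 hy
          refine ⟨1, C.one_mem, Function.update 1 t a, ?_⟩
          rw [← Finset.mul_prod_erase _ _ (Finset.mem_univ t), Function.update_self,
            Finset.prod_eq_one, one_mul, mul_one]
          intro u hu
          rw [Function.update_of_ne (Finset.ne_of_mem_erase hu), Pi.one_apply, map_one]
      refine Subring.closure_induction (fun y hy => AddSubmonoid.subset_closure (hM hy))
        (zero_mem _) (AddSubmonoid.subset_closure M.one_mem) (fun _ _ _ _ => add_mem)
        (fun y _ hy => ?_) (fun y z _ _ hy hz => ?_) hx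
      · refine AddSubmonoid.closure_induction (motive := fun y _ => -y ∈ _) ?_ ?_ ?_ hy
        · rintro _ ⟨c, hc, a, rfl⟩
          exact AddSubmonoid.subset_closure ⟨-c, C.neg_mem hc, a, by ring⟩
        · simp
        · intro y z _ _ hy hz
          rw [neg_add]
          exact add_mem hy hz
      · have h := AddSubmonoid.mul_mem_mul hy hz
        rw [AddSubmonoid.closure_mul_closure] at h
        refine AddSubmonoid.closure_mono ?_ h
        rintro _ ⟨u, hu, v, hv, rfl⟩
        exact M.mul_mem hu hv
    intro x
    refine AddSubmonoid.closure_induction (motive := fun x _ => ∑ σ, ρ σ x ∈ P) ?_ ?_ ?_ (hspan x)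
    · rintro _ ⟨c, hc, a, rfl⟩
      have : ∑ σ, ρ σ (c * ∏ t, ι t (a t)) =
          c * ∑ τ : Fin n → Fin n with Function.Injective τ, ∏ t, ι (τ t) (a t) := by
        rw [Finset.mul_sum]
        refine Finset.sum_bij (fun σ _ => ⇑σ) (by simp [Equiv.injective])
          (fun _ _ _ _ h => DFunLike.coe_injective h) (fun τ hτ => ?_) (fun σ _ => ?_)
        · have hτ' : Function.Injective τ := (Finset.mem_filter.1 hτ).2
          exact ⟨Equiv.ofBijective τ (Finite.injective_iff_bijective.1 hτ'), Finset.mem_univ _, rfl⟩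
        · simp [map_prod, hρC σ c hc, hρ]
      rw [this]
      exact P.mul_mem (hC hc) (sum_injective_prod_mem ι P hP n a)
    · simp
    · intro x y _ _ hx hy
      simp only [map_add, Finset.sum_add_distrib]
      exact P.add_mem hx hy
  -- an invariant is `(n!)⁻¹` times the sum over its orbit
  have h := hsym s
  simp only [hs, Finset.sum_const, Finset.card_univ, nsmul_eq_mul] at h
  have h2 := P.mul_mem (hQ ((Fintype.card (Equiv.Perm (Fin n)) : ℚ)⁻¹)) h
  have h3 : (Fintype.card (Equiv.Perm (Fin n)) : ℚ) ≠ 0 :=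
    Nat.cast_ne_zero.2 Fintype.card_ne_zero
  rwa [← mul_assoc, ← map_natCast (algebraMap ℚ E), ← map_mul, inv_mul_cancel₀ h3, map_one,
    one_mul] at h2

end Powersums

/-! ### Integrality over weighted power sums -/

section Integral

open MvPolynomial

/-- A Vandermonde argument. If the `t j` satisfy `∑ j, w j i * t j ^ n = 0` for all `n > 0`, then
so does `∑ j, w j i * (t j * g (t j)) = 0` for all polynomials `g`; one that vanishes at all values
except `t j` isolates the sum of the weights with value `t j`. -/
theorem eq_zero_of_weighted_sums_eq_zero {k : ℕ} {ι D : Type*} [CommRing D] [IsDomain D]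
    (w : Fin k → ι → D) (hw : ∀ S : Finset (Fin k), S.Nonempty → ∃ i, ∑ j ∈ S, w j i ≠ 0)
    (t : Fin k → D) (h : ∀ n, 0 < n → ∀ i, ∑ j, w j i * t j ^ n = 0) (j : Fin k) : t j = 0 := by
  classical
  by_contra hj
  have hpoly : ∀ (g : Polynomial D) (i : ι), ∑ l, w l i * (t l * g.eval (t l)) = 0 := by
    intro g i
    induction g using Polynomial.induction_on' with
    | add p q hp hq =>
      simp only [Polynomial.eval_add, mul_add, Finset.sum_add_distrib, hp, hq, add_zero]
    | monomial n c =>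
      have := h (n + 1) n.succ_pos i
      simp only [Polynomial.eval_monomial]
      calc _ = c * ∑ l, w l i * t l ^ (n + 1) := by
            rw [Finset.mul_sum]; exact Finset.sum_congr rfl fun l _ => by ring
        _ = 0 := by rw [this, mul_zero]
  let S := Finset.univ.filter fun l => t l = t j
  obtain ⟨i, hi⟩ := hw S ⟨j, by simp [S]⟩
  -- the polynomial that vanishes at all values except `t j`
  let g : Polynomial D := ∏ v ∈ (Finset.univ.image t).erase (t j), (Polynomial.X - Polynomial.C v)
  have hg := hpoly g i
  have hgne : g.eval (t j) ≠ 0 := by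
    rw [Polynomial.eval_prod, Finset.prod_ne_zero_iff]
    intro v hv
    simpa [sub_eq_zero] using (Finset.ne_of_mem_erase hv).symm
  have h0 : ∀ l, t l ≠ t j → g.eval (t l) = 0 := by
    intro l hl
    rw [Polynomial.eval_prod]
    exact Finset.prod_eq_zero (i := t l) (by simp [hl]) (by simp)
  have : ∑ l, w l i * (t l * g.eval (t l)) = (∑ l ∈ S, w l i) * (t j * g.eval (t j)) := by
    rw [Finset.sum_mul, Finset.sum_filter]
    refine Finset.sum_congr rfl fun l _ => ?_
    split_ifs with hl
    · rw [hl]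
    · rw [h0 l hl, mul_zero, mul_zero]
  rw [this] at hg
  exact mul_ne_zero hi (mul_ne_zero hj hgne) hg

/-- The weighted power sum `∑ j, w j i * X j ^ n`, for the `i`-th component of the weights. -/
def weightedPsum {k : ℕ} {ι K : Type*} [CommRing K] (w : Fin k → ι → K) (n : ℕ) (i : ι) :
    MvPolynomial (Fin k) K :=
  ∑ j, C (w j i) * X j ^ n

theorem isHomogeneous_weightedPsum {k : ℕ} {ι K : Type*} [CommRing K] (w : Fin k → ι → K)
    (n : ℕ) (i : ι) : (weightedPsum w n i).IsHomogeneous n :=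
  IsHomogeneous.sum _ _ _ fun j _ => by
    simpa using (isHomogeneous_C _ (w j i)).mul (isHomogeneous_X_pow j n)

/-- If the sums of the weights over nonempty sets of indices generate the unit ideal, then the
weighted power sums of positive degree have no common zero but the origin, in any domain over `K`;
hence the ideal that they generate contains a power of every variable. -/
theorem exists_pow_mem_span_weightedPsum {k : ℕ} {ι K : Type*} [CommRing K] (w : Fin k → ι → K)
    (hw : ∀ S : Finset (Fin k), S.Nonempty → ∀ p : Ideal K, p.IsPrime →
      ∃ i, ∑ j ∈ S, w j i ∉ p) :
    ∃ N, ∀ j, (X j : MvPolynomial (Fin k) K) ^ N ∈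
      Ideal.span (Set.range fun q : ℕ × ι => weightedPsum w (q.1 + 1) q.2) := by
  set I := Ideal.span (Set.range fun q : ℕ × ι => weightedPsum w (q.1 + 1) q.2) with hI
  have hrad : ∀ j, (X j : MvPolynomial (Fin k) K) ∈ I.radical := by
    intro j
    rw [Ideal.radical_eq_sInf, Ideal.mem_sInf]
    rintro P ⟨hIP, hP⟩
    rw [← Ideal.Quotient.eq_zero_iff_mem]
    refine eq_zero_of_weighted_sums_eq_zero (D := MvPolynomial (Fin k) K ⧸ P)
      (fun j i => Ideal.Quotient.mk P (C (w j i))) (fun S hS => ?_)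
      (fun j => Ideal.Quotient.mk P (X j)) (fun n hn i => ?_) j
    · obtain ⟨i, hi⟩ := hw S hS (P.comap C) inferInstance
      refine ⟨i, fun h => hi ?_⟩
      rw [Ideal.mem_comap, ← Ideal.Quotient.eq_zero_iff_mem, map_sum, map_sum]
      exact h
    · have : weightedPsum w n i ∈ P := hIP (Ideal.subset_span ⟨(n - 1, i), by
        simp [Nat.sub_add_cancel hn]⟩)
      rw [← Ideal.Quotient.eq_zero_iff_mem, weightedPsum] at this
      simpa using this
  choose N hN using hrad
  refine ⟨∑ j, N j, fun j => I.pow_mem_of_pow_mem (hN j) ?_⟩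
  exact Finset.single_le_sum (fun _ _ => Nat.zero_le _) (Finset.mem_univ j)

/-- A homogeneous element of an ideal generated by homogeneous polynomials of positive degree is a
combination of the generators with coefficients of smaller degree. -/
theorem exists_eq_sum_of_mem_span {σ Q K : Type*} [CommRing K] {N : ℕ}
    (p : Q → MvPolynomial σ K) (d : Q → ℕ) (hd : ∀ q, 0 < d q) (hp : ∀ q, (p q).IsHomogeneous (d q))
    {F : MvPolynomial σ K} (hF : F.IsHomogeneous N) (hN : 0 < N)
    (hmem : F ∈ Ideal.span (Set.range p)) :
    ∃ c : Q →₀ MvPolynomial σ K, F = c.sum (fun q x => x * p q) ∧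
      ∀ q, (c q).totalDegree < N := by
  classical
  let := MvPolynomial.gradedAlgebra (σ := σ) (R := K)
  have hdec : ∀ (x : MvPolynomial σ K) (n : ℕ),
      (DirectSum.decompose (homogeneousSubmodule σ K) x n : MvPolynomial σ K) =
        homogeneousComponent n x := fun x n => MvPolynomial.decomposition.decompose'_apply x n
  obtain ⟨c, hc⟩ := (Finsupp.mem_ideal_span_range_iff_exists_finsupp).1 hmem
  let comp : Q → MvPolynomial σ K → MvPolynomial σ K := fun q x =>
    if d q ≤ N then homogeneousComponent (N - d q) x else 0
  have hcomp0 : ∀ q, comp q 0 = 0 := fun q => by simp [comp]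
  have hcomp : ∀ q x, homogeneousComponent N (x * p q) = comp q x * p q := by
    intro q x
    have := hp q
    have hq : p q ∈ homogeneousSubmodule σ K (d q) := this
    simp only [comp]
    split_ifs with h
    · have := DirectSum.coe_decompose_mul_of_right_mem_of_le (homogeneousSubmodule σ K)
        (a := x) hq h
      rw [← hdec, this, hdec]
    · have := DirectSum.coe_decompose_mul_of_right_mem_of_not_le (homogeneousSubmodule σ K)
        (a := x) hq h
      rw [← hdec, this, zero_mul]
  refine ⟨Finsupp.onFinset c.support (fun q => comp q (c q)) (fun q hq => ?_), ?_, fun q => ?_⟩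
  · rw [Finsupp.mem_support_iff]
    rintro h
    exact hq (by rw [h, hcomp0])
  · rw [Finsupp.onFinset_sum _ (by simp)]
    have : F = homogeneousComponent N F := (homogeneousComponent_of_mem (n := N) hF |>.trans
      (if_pos rfl)).symm
    rw [this, ← hc, Finsupp.sum, map_sum]
    exact Finset.sum_congr rfl fun q _ => hcomp q _
  · simp only [Finsupp.onFinset_apply, comp]
    split_ifs with h
    · have := (homogeneousComponent_isHomogeneous (N - d q) (c q)).totalDegree_le
      have := hd q
      omega
    · simpa using hN

/-- If the sums of the weights over nonempty sets of indices generate the unit ideal, and the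
weighted power sums of `t` lie in `K`, then every `t j` is integral over `K`. Modulo combinations of
weighted power sums, a large power of a variable can be replaced by polynomials of smaller
degree; so the monomials with bounded exponents span `K[t]` over `K`. -/
theorem isIntegral_of_weighted_psums_mem {k : ℕ} {ι K B : Type*} [CommRing K] [CommRing B]
    [Algebra K B] (w : Fin k → ι → K)
    (hw : ∀ S : Finset (Fin k), S.Nonempty → ∀ p : Ideal K, p.IsPrime →
      ∃ i, ∑ j ∈ S, w j i ∉ p)
    (t : Fin k → B)
    (ht : ∀ n i, ∑ j, algebraMap K B (w j i) * t j ^ (n + 1) ∈ Set.range (algebraMap K B))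
    (j : Fin k) : IsIntegral K (t j) := by
  classical
  obtain ⟨N, hN⟩ := exists_pow_mem_span_weightedPsum w hw
  -- the exponent `N + 1` is positive, so that the coefficients have smaller degree
  have hN' : ∀ j, ∃ c : (ℕ × ι) →₀ MvPolynomial (Fin k) K,
      (X j : MvPolynomial (Fin k) K) ^ (N + 1) =
        c.sum (fun q x => x * weightedPsum w (q.1 + 1) q.2) ∧
      ∀ q, (c q).totalDegree < N + 1 := by
    intro j
    refine exists_eq_sum_of_mem_span (fun q : ℕ × ι => weightedPsum w (q.1 + 1) q.2)
      (fun q => q.1 + 1) (fun q => q.1.succ_pos) (fun q => isHomogeneous_weightedPsum w _ _)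
      (isHomogeneous_X_pow j _) N.succ_pos ?_
    rw [pow_succ]
    exact Ideal.mul_mem_right _ _ (hN j)
  choose c hc hcdeg using hN'
  let M : Submodule K B := Submodule.span K
    (Set.range fun a : Fin k → Fin (N + 1) => ∏ j, t j ^ (a j : ℕ))
  have hfin : M.FG := Submodule.fg_span (Set.finite_range _)
  have hmem : ∀ (d : ℕ) (F : MvPolynomial (Fin k) K), F.totalDegree ≤ d → aeval t F ∈ M := by
    intro d
    induction d using Nat.strong_induction_on with
    | _ d ih =>
    intro F hF
    rw [F.as_sum, map_sum]
    refine M.sum_mem fun a ha => ?_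
    have had : (monomial a (1 : K)).totalDegree ≤ d :=
      ((totalDegree_monomial_le _ _).trans (le_totalDegree ha)).trans hF
    have hsm : monomial a (coeff a F) = coeff a F • monomial a (1 : K) := by
      rw [smul_monomial, smul_eq_mul, mul_one]
    rw [hsm, map_smul]
    refine M.smul_mem _ ?_
    by_cases hsmall : ∀ j, a j < N + 1
    · refine Submodule.subset_span ⟨fun j => ⟨a j, hsmall j⟩, ?_⟩
      rw [aeval_monomial, map_one, one_mul, Finsupp.prod_fintype _ _ (by simp)]
    · push Not at hsmall
      obtain ⟨j, hj⟩ := hsmall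
      have hdeg : a.degree ≤ d := (le_totalDegree ha).trans hF
      set b := a - Finsupp.single j (N + 1) with hb
      have hab : a = Finsupp.single j (N + 1) + b := by
        rw [hb, add_tsub_cancel_of_le]
        exact Finsupp.single_le_iff.2 hj
      have hbd : b.degree + (N + 1) = a.degree := by
        rw [hab, map_add, Finsupp.degree_single, add_comm]
      have : monomial a (1 : K) = X j ^ (N + 1) * monomial b 1 := by
        rw [hab, X_pow_eq_monomial, monomial_mul, one_mul]
      rw [this, hc j, Finsupp.sum, Finset.sum_mul, map_sum]
      refine M.sum_mem fun q _ => ?_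
      obtain ⟨y, hy⟩ := ht q.1 q.2
      have hpq : aeval t (weightedPsum w (q.1 + 1) q.2) = algebraMap K B y := by
        rw [hy, weightedPsum]
        simp
      have : aeval t (c j q * weightedPsum w (q.1 + 1) q.2 * monomial b 1) =
          y • aeval t (c j q * monomial b 1) := by
        rw [map_mul, map_mul, hpq, map_mul, Algebra.smul_def]
        ring
      rw [this]
      refine M.smul_mem _ (ih (d - 1) (by omega) _ ?_)
      refine (totalDegree_mul _ _).trans ?_
      have h1 := hcdeg j q
      have h2 : (monomial b (1 : K)).totalDegree ≤ b.degree := totalDegree_monomial_le _ _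
      omega
  have hle : (Algebra.adjoin K (Set.range t)).toSubmodule = M := by
    refine le_antisymm ?_ ?_
    · intro x hx
      rw [Subalgebra.mem_toSubmodule, Algebra.adjoin_range_eq_range_aeval] at hx
      obtain ⟨F, rfl⟩ := hx
      exact hmem _ F le_rfl
    · refine Submodule.span_le.2 ?_
      rintro _ ⟨a, rfl⟩
      exact Subalgebra.prod_mem _ fun j _ => Subalgebra.pow_mem _
        (Algebra.subset_adjoin (Set.mem_range_self j)) _
  exact IsIntegral.of_mem_of_fg _ (hle ▸ hfin) _ (Algebra.subset_adjoin (Set.mem_range_self j))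

end Integral

/-! ### Products of affine schemes over `ℂ` -/

section Tensor

open TensorProduct

/-- The Nullstellensatz: a nonzero function on a reduced scheme of finite type over an
algebraically closed field does not vanish at all rational points. -/
theorem exists_algHom_ne_zero {K A : Type*} [Field K] [IsAlgClosed K] [CommRing A] [Algebra K A]
    [Algebra.FiniteType K A] [_root_.IsReduced A] {a : A} (ha : a ≠ 0) :
    ∃ φ : A →ₐ[K] K, φ a ≠ 0 := by
  have : IsJacobsonRing A := isJacobsonRing_of_finiteType (A := K)
  have hj : a ∉ (⊥ : Ideal A).jacobson := by
    rw [← Ideal.radical_eq_jacobson]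
    intro h
    exact ha ((Ideal.isRadical_bot (R := A)) h)
  rw [Ideal.jacobson, Ideal.mem_sInf] at hj
  push Not at hj
  obtain ⟨m, ⟨_, hm⟩, ham⟩ := hj
  have : Module.Finite K (A ⧸ m) := by
    let := Ideal.Quotient.field m
    exact finite_of_finite_type_of_isJacobsonRing K (A ⧸ m)
  have hbij : Function.Bijective (algebraMap K (A ⧸ m)) :=
    IsAlgClosed.algebraMap_bijective_of_isIntegral
  refine ⟨(AlgEquiv.ofBijective (Algebra.ofId K (A ⧸ m)) hbij).symm.toAlgHom.comp
    (Ideal.Quotient.mkₐ K m), ?_⟩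
  simpa [Ideal.Quotient.eq_zero_iff_mem] using ham

variable {K A B : Type*} [Field K] [CommRing A] [Algebra K A] [CommRing B] [Algebra K B]

/-- Evaluation of the first tensor factor at a rational point `φ`. -/
def evalLeft (φ : A →ₐ[K] K) : A ⊗[K] B →ₐ[K] B :=
  (Algebra.TensorProduct.lid K B).toAlgHom.comp (Algebra.TensorProduct.map φ (AlgHom.id K B))

theorem repr_evalLeft {ι : Type*} (b : Module.Basis ι K B) (φ : A →ₐ[K] K) (x : A ⊗[K] B) (i : ι) :
    b.repr (evalLeft φ x) i = φ ((Algebra.TensorProduct.basis A b).repr x i) := by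
  induction x using TensorProduct.induction_on with
  | zero => simp
  | add x y hx hy => simp [hx, hy]
  | tmul a y => simp [evalLeft, Algebra.TensorProduct.basis_repr_tmul]

/-- Only one factor has to be of finite type: a nilpotent tensor vanishes after evaluation of that
factor at every rational point, so its coordinates in a basis of the other factor vanish. -/
theorem isReduced_tensorProduct [IsAlgClosed K] [Algebra.FiniteType K A] [_root_.IsReduced A]
    [_root_.IsReduced B] : _root_.IsReduced (A ⊗[K] B) := by
  refine ⟨fun x hx => ?_⟩
  let b := Module.Basis.ofVectorSpace K B
  by_contra h
  obtain ⟨i, hi⟩ : ∃ i, (Algebra.TensorProduct.basis A b).repr x i ≠ 0 := by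
    by_contra! h'
    exact h ((Algebra.TensorProduct.basis A b).repr.map_eq_zero_iff.1 (Finsupp.ext h'))
  obtain ⟨φ, hφ⟩ := exists_algHom_ne_zero (K := K) hi
  rw [← repr_evalLeft, (hx.map (evalLeft φ)).eq_zero] at hφ
  simp at hφ

/-- If `x` and `y` are nonzero, some rational point of the first factor avoids the zeros of a
coordinate of each of them; evaluated there, they stay nonzero. -/
theorem isDomain_tensorProduct [IsAlgClosed K] [Algebra.FiniteType K A] [IsDomain A]
    [IsDomain B] : IsDomain (A ⊗[K] B) := by
  let b := Module.Basis.ofVectorSpace K B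
  have hne : ∀ x : A ⊗[K] B, x ≠ 0 → ∃ i, (Algebra.TensorProduct.basis A b).repr x i ≠ 0 := by
    intro x h
    by_contra! h'
    exact h ((Algebra.TensorProduct.basis A b).repr.map_eq_zero_iff.1 (Finsupp.ext h'))
  have hev : ∀ (φ : A →ₐ[K] K) (x : A ⊗[K] B) (i),
      φ ((Algebra.TensorProduct.basis A b).repr x i) ≠ 0 → evalLeft φ x ≠ 0 := by
    intro φ x i h h'
    rw [← repr_evalLeft, h'] at h
    simp at h
  have : Nontrivial (A ⊗[K] B) := by
    obtain ⟨φ, hφ⟩ := exists_algHom_ne_zero (K := K) (one_ne_zero (α := A))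
    exact (evalLeft (B := B) φ).toRingHom.domain_nontrivial
  have : NoZeroDivisors (A ⊗[K] B) := by
    refine ⟨fun {x y} hxy => ?_⟩
    by_contra! h
    obtain ⟨i, hi⟩ := hne x h.1
    obtain ⟨j, hj⟩ := hne y h.2
    obtain ⟨φ, hφ⟩ := exists_algHom_ne_zero (K := K) (mul_ne_zero hi hj)
    rw [map_mul] at hφ
    have h2 := mul_ne_zero (hev φ x i (left_ne_zero_of_mul hφ))
      (hev φ y j (right_ne_zero_of_mul hφ))
    rw [← map_mul, hxy, map_zero] at h2
    exact h2 rfl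
  exact NoZeroDivisors.to_isDomain _

end Tensor

section Products

/-- The fiber product of affine schemes over `ℂ` is the spectrum of a tensor product over `ℂ`. -/
theorem exists_iso_pullback_tensor {Y Z : Scheme.{0}} [IsAffine Y] [IsAffine Z] (f : Y ⟶ SpecC)
    (g : Z ⟶ SpecC) [LocallyOfFiniteType f] :
    ∃ (A B : CommRingCat.{0}) (_ : Algebra ℂ A) (_ : Algebra ℂ B) (_ : Y ≅ Spec A)
      (_ : Z ≅ Spec B) (_ : pullback f g ≅ Spec (CommRingCat.of (TensorProduct ℂ A B))),
      Algebra.FiniteType ℂ A := by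
  let φ : CommRingCat.of ℂ ⟶ Γ(Y, ⊤) := Spec.preimage (Y.isoSpec.inv ≫ f)
  let ψ : CommRingCat.of ℂ ⟶ Γ(Z, ⊤) := Spec.preimage (Z.isoSpec.inv ≫ g)
  let := φ.hom.toAlgebra
  let := ψ.hom.toAlgebra
  have hφ : Y.isoSpec.hom ≫ Spec.map φ = f := by simp [φ]
  have hψ : Z.isoSpec.hom ≫ Spec.map ψ = g := by simp [ψ]
  refine ⟨Γ(Y, ⊤), Γ(Z, ⊤), φ.hom.toAlgebra, ψ.hom.toAlgebra, Y.isoSpec, Z.isoSpec,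
    ?_ ≪≫ pullbackSpecIso ℂ Γ(Y, ⊤) Γ(Z, ⊤), ?_⟩
  · exact asIso (pullback.map f g (Spec.map φ) (Spec.map ψ) Y.isoSpec.hom Z.isoSpec.hom (𝟙 _)
      (by rw [hφ, Category.comp_id]) (by rw [hψ, Category.comp_id]))
  · have : LocallyOfFiniteType (Spec.map φ) := by
      rw [show Spec.map φ = Y.isoSpec.inv ≫ f by simp [φ]]
      infer_instance
    exact (HasRingHomProperty.Spec_iff (P := @LocallyOfFiniteType)).1 this

theorem isReduced_pullback {Y Z : Scheme.{0}} [IsAffine Y] [IsAffine Z] (f : Y ⟶ SpecC)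
    (g : Z ⟶ SpecC) [LocallyOfFiniteType f] [IsReduced Y] [IsReduced Z] :
    IsReduced (pullback f g) := by
  obtain ⟨A, B, _, _, eY, eZ, e, _⟩ := exists_iso_pullback_tensor f g
  have : IsReduced (Spec A) := isReduced_of_isOpenImmersion eY.inv
  have : IsReduced (Spec B) := isReduced_of_isOpenImmersion eZ.inv
  have : _root_.IsReduced A := (affine_isReduced_iff A).1 inferInstance
  have : _root_.IsReduced B := (affine_isReduced_iff B).1 inferInstance
  have : IsReduced (Spec (CommRingCat.of (TensorProduct ℂ A B))) :=
    (affine_isReduced_iff _).2 isReduced_tensorProduct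
  exact isReduced_of_isOpenImmersion e.hom

theorem isIntegral_of_iso {Y Z : Scheme.{0}} (e : Y ≅ Z) [IsIntegral Y] : IsIntegral Z :=
  have : Nonempty Z := Nonempty.map e.hom inferInstance
  isIntegral_of_isOpenImmersion e.inv

theorem isIntegral_pullback {Y Z : Scheme.{0}} [IsAffine Y] [IsAffine Z] (f : Y ⟶ SpecC)
    (g : Z ⟶ SpecC) [LocallyOfFiniteType f] [IsIntegral Y] [IsIntegral Z] :
    IsIntegral (pullback f g) := by
  obtain ⟨A, B, _, _, eY, eZ, e, _⟩ := exists_iso_pullback_tensor f g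
  have : IsIntegral (Spec A) := isIntegral_of_iso eY
  have : IsIntegral (Spec B) := isIntegral_of_iso eZ
  have : IsDomain A := (affine_isIntegral_iff A).1 inferInstance
  have : IsDomain B := (affine_isIntegral_iff B).1 inferInstance
  have : IsIntegral (Spec (CommRingCat.of (TensorProduct ℂ A B))) :=
    (affine_isIntegral_iff _).2 isDomain_tensorProduct
  exact isIntegral_of_iso e.symm

/-- A property of schemes over `ℂ` that is inherited by binary fiber products is inherited by
finite products. -/
theorem prop_piObj (P : Over SpecC → Prop) (hiso : ∀ {Y Z : Over SpecC}, (Y ≅ Z) → P Y → P Z)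
    (h0 : P (Over.mk (𝟙 SpecC)))
    (h2 : ∀ Y Z : Over SpecC, P Y → P Z → P (Over.mk (pullback.fst Y.hom Z.hom ≫ Y.hom)))
    {n : ℕ} (Z : Fin n → Over SpecC) (hZ : ∀ i, P (Z i)) : P (∏ᶜ Z) := by
  induction n with
  | zero =>
    refine hiso ?_ h0
    exact (Over.mkIdTerminal (X := SpecC)).uniqueUpToIso
      { lift := fun s => Limits.Pi.lift fun i => Fin.elim0 i
        fac := fun s j => j.as.elim
        uniq := fun s m _ => Limits.Pi.hom_ext _ _ fun i => Fin.elim0 i }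
  | succ n ih =>
    have h := h2 _ _ (hZ 0) (ih (fun i => Z i.succ) fun i => hZ i.succ)
    have h' : P (Z 0 ⨯ ∏ᶜ fun i : Fin n => Z i.succ) :=
      hiso (Over.isoMk (Over.prodLeftIsoPullback _ _).symm (by
        rw [Iso.symm_hom, Iso.inv_comp_eq]
        simp)) h
    refine hiso ?_ h'
    exact (extendFanIsLimit Z (productIsProduct fun i : Fin n => Z i.succ)
      (prodIsProd (Z 0) (∏ᶜ fun i : Fin n => Z i.succ))).conePointUniqueUpToIso
        (productIsProduct Z)

theorem isAffine_of_overIso {Y Z : Over SpecC} (e : Y ≅ Z) (h : IsAffine Y.left) :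
    IsAffine Z.left :=
  let i : Y.left ≅ Z.left := (Over.forget _).mapIso e
  IsAffine.of_isIso i.inv

theorem locallyOfFiniteType_of_overIso {Y Z : Over SpecC} (e : Y ≅ Z)
    (h : LocallyOfFiniteType Y.hom) : LocallyOfFiniteType Z.hom := by
  let i : Y.left ≅ Z.left := (Over.forget _).mapIso e
  rw [← Over.w e.inv]
  exact inferInstanceAs (LocallyOfFiniteType (i.inv ≫ Y.hom))

theorem isAffine_piObj {n : ℕ} (Z : Fin n → Over SpecC) (hZ : ∀ i, IsAffine (Z i).left) :
    IsAffine (∏ᶜ Z).left :=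
  prop_piObj (fun Y => IsAffine Y.left) isAffine_of_overIso (isAffine_Spec _)
    (fun _ _ _ _ => inferInstanceAs (IsAffine (pullback _ _))) Z hZ

theorem locallyOfFiniteType_piObj {n : ℕ} (Z : Fin n → Over SpecC)
    (hZ : ∀ i, LocallyOfFiniteType (Z i).hom) : LocallyOfFiniteType (∏ᶜ Z).hom :=
  prop_piObj (fun Y => LocallyOfFiniteType Y.hom) locallyOfFiniteType_of_overIso
    (inferInstanceAs (LocallyOfFiniteType (𝟙 SpecC)))
    (fun _ _ _ _ => inferInstanceAs (LocallyOfFiniteType (pullback.fst _ _ ≫ _))) Z hZ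

theorem isReduced_SpecC : IsReduced SpecC :=
  (affine_isReduced_iff _).2 (inferInstanceAs (_root_.IsReduced ℂ))

theorem isIntegral_SpecC : IsIntegral SpecC :=
  (affine_isIntegral_iff _).2 (inferInstanceAs (IsDomain ℂ))

theorem isReduced_piObj {n : ℕ} (Z : Fin n → Over SpecC) (hZ : ∀ i, IsAffine (Z i).left)
    (hZ' : ∀ i, LocallyOfFiniteType (Z i).hom) (hr : ∀ i, IsReduced (Z i).left) :
    IsReduced (∏ᶜ Z).left := by
  refine (prop_piObj
    (fun Y => IsAffine Y.left ∧ LocallyOfFiniteType Y.hom ∧ IsReduced Y.left) ?_ ?_ ?_ Z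
    fun i => ⟨hZ i, hZ' i, hr i⟩).2.2
  · rintro Y Z e ⟨h1, h2, h3⟩
    let i : Y.left ≅ Z.left := (Over.forget _).mapIso e
    exact ⟨isAffine_of_overIso e h1, locallyOfFiniteType_of_overIso e h2,
      isReduced_of_isOpenImmersion i.inv⟩
  · exact ⟨isAffine_Spec _, inferInstanceAs (LocallyOfFiniteType (𝟙 SpecC)), isReduced_SpecC⟩
  · rintro Y Z ⟨h1, h2, h3⟩ ⟨h1', h2', h3'⟩
    exact ⟨inferInstanceAs (IsAffine (pullback _ _)),
      inferInstanceAs (LocallyOfFiniteType (pullback.fst _ _ ≫ _)), isReduced_pullback _ _⟩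

theorem isIntegral_piObj {n : ℕ} (Z : Fin n → Over SpecC) (hZ : ∀ i, IsAffine (Z i).left)
    (hZ' : ∀ i, LocallyOfFiniteType (Z i).hom) (hr : ∀ i, IsIntegral (Z i).left) :
    IsIntegral (∏ᶜ Z).left := by
  refine (prop_piObj
    (fun Y => IsAffine Y.left ∧ LocallyOfFiniteType Y.hom ∧ IsIntegral Y.left) ?_ ?_ ?_ Z
    fun i => ⟨hZ i, hZ' i, hr i⟩).2.2
  · rintro Y Z e ⟨h1, h2, h3⟩
    let i : Y.left ≅ Z.left := (Over.forget _).mapIso e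
    exact ⟨isAffine_of_overIso e h1, locallyOfFiniteType_of_overIso e h2, isIntegral_of_iso i⟩
  · exact ⟨isAffine_Spec _, inferInstanceAs (LocallyOfFiniteType (𝟙 SpecC)), isIntegral_SpecC⟩
  · rintro Y Z ⟨h1, h2, h3⟩ ⟨h1', h2', h3'⟩
    exact ⟨inferInstanceAs (IsAffine (pullback _ _)),
      inferInstanceAs (LocallyOfFiniteType (pullback.fst _ _ ≫ _)), isIntegral_pullback _ _⟩

end Products

/-! ### Spectra of rings of regular functions -/

theorem comp_appTop_apply {X Y Z : Scheme.{0}} (f : X ⟶ Y) (g : Y ⟶ Z) (s : Γ(Z, ⊤)) :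
    (f ≫ g).appTop.hom s = f.appTop.hom (g.appTop.hom s) := by
  rw [Scheme.Hom.comp_appTop]
  rfl

theorem over_comp_appTop_apply {S : Scheme.{0}} {X Y Z : Over S} (f : X ⟶ Y) (g : Y ⟶ Z)
    (s : Γ(Z.left, ⊤)) :
    (f ≫ g).left.appTop.hom s = f.left.appTop.hom (g.left.appTop.hom s) :=
  comp_appTop_apply f.left g.left s

section Spectrum

variable {A₀ : CommRingCat.{0}}

/-- The structure map `A₀ → Γ(Y)` of a scheme over `Spec A₀`. -/
def scalars (Y : Over (Spec A₀)) : A₀ →+* Γ(Y.left, ⊤) :=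
  ((Scheme.ΓSpecIso A₀).inv ≫ Y.hom.appTop).hom

theorem toSpecΓ_map_scalars (Y : Over (Spec A₀)) :
    Y.left.toSpecΓ ≫ Spec.map (CommRingCat.ofHom (scalars Y)) = Y.hom := by
  change _ ≫ Spec.map ((Scheme.ΓSpecIso A₀).inv ≫ Y.hom.appTop) = _
  rw [Spec.map_comp, ← Scheme.toSpecΓ_naturality_assoc]
  simp

theorem appTop_scalars {Y Z : Over (Spec A₀)} (f : Y ⟶ Z) (c : A₀) :
    f.left.appTop.hom (scalars Z c) = scalars Y c := by
  have h : f.left ≫ Z.hom = Y.hom := Over.w f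
  change (((Scheme.ΓSpecIso A₀).inv ≫ Z.hom.appTop) ≫ f.left.appTop).hom c = _
  rw [Category.assoc, ← Scheme.Hom.comp_appTop, h]
  rfl

/-- The spectrum of a ring `S` of regular functions on `Y` that contains the scalars. -/
def spectrum (Y : Over (Spec A₀)) (S : Subring Γ(Y.left, ⊤)) (hS : ∀ c, scalars Y c ∈ S) :
    Over (Spec A₀) :=
  Over.mk (Spec.map (CommRingCat.ofHom ((scalars Y).codRestrict S hS)))

/-- The morphism from `Y` to the spectrum of a ring `S` of regular functions on `Y`, given by the
inclusion of `S`. -/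
def toSpectrum (Y : Over (Spec A₀)) (S : Subring Γ(Y.left, ⊤)) (hS : ∀ c, scalars Y c ∈ S) :
    Y ⟶ spectrum Y S hS :=
  Over.homMk (Y.left.toSpecΓ ≫ Spec.map (CommRingCat.ofHom S.subtype)) (by
    change (_ ≫ Spec.map _) ≫ Spec.map _ = _
    rw [Category.assoc, ← Spec.map_comp, ← CommRingCat.ofHom_comp, ← toSpecΓ_map_scalars]
    rfl)

/-- The morphism of spectra induced by a morphism that pulls `T` back into `S`. -/
def spectrumMap {Y Z : Over (Spec A₀)} {S : Subring Γ(Y.left, ⊤)} {hS : ∀ c, scalars Y c ∈ S}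
    {T : Subring Γ(Z.left, ⊤)} {hT : ∀ c, scalars Z c ∈ T} (f : Y ⟶ Z)
    (h : ∀ s ∈ T, f.left.appTop.hom s ∈ S) : spectrum Y S hS ⟶ spectrum Z T hT :=
  Over.homMk (Spec.map (CommRingCat.ofHom (f.left.appTop.hom.restrict T S h))) (by
    change Spec.map _ ≫ Spec.map _ = Spec.map _
    rw [← Spec.map_comp, ← CommRingCat.ofHom_comp]
    congr 2
    ext c
    exact appTop_scalars f c)

theorem toSpectrum_spectrumMap {Y Z : Over (Spec A₀)} {S : Subring Γ(Y.left, ⊤)}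
    {hS : ∀ c, scalars Y c ∈ S} {T : Subring Γ(Z.left, ⊤)} {hT : ∀ c, scalars Z c ∈ T} (f : Y ⟶ Z)
    (h : ∀ s ∈ T, f.left.appTop.hom s ∈ S) :
    toSpectrum Y S hS ≫ spectrumMap (hT := hT) f h = f ≫ toSpectrum Z T hT := by
  ext1
  change (_ ≫ Spec.map _) ≫ Spec.map _ = f.left ≫ (_ ≫ Spec.map _)
  have h : CommRingCat.ofHom (f.left.appTop.hom.restrict T S h) ≫ CommRingCat.ofHom S.subtype =
      CommRingCat.ofHom T.subtype ≫ f.left.appTop := rfl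
  rw [Category.assoc, ← Spec.map_comp, h, Spec.map_comp, ← Scheme.toSpecΓ_naturality_assoc]

/-- A morphism to an affine scheme whose pullbacks lie in `S` factors through the spectrum. -/
theorem exists_toSpectrum_comp_eq {Y Z : Over (Spec A₀)} (hZ : IsAffine Z.left)
    {S : Subring Γ(Y.left, ⊤)} {hS : ∀ c, scalars Y c ∈ S} (f : Y ⟶ Z)
    (h : ∀ s, f.left.appTop.hom s ∈ S) : ∃ g, toSpectrum Y S hS ≫ g = f := by
  have hT : ∀ c, scalars Z c ∈ (⊤ : Subring Γ(Z.left, ⊤)) := fun _ => trivial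
  have : IsIso (CommRingCat.ofHom (⊤ : Subring Γ(Z.left, ⊤)).subtype) :=
    inferInstanceAs (IsIso (Subring.topEquiv (R := Γ(Z.left, ⊤))).toCommRingCatIso.hom)
  have : IsIso (toSpectrum Z ⊤ hT).left := by
    change IsIso (_ ≫ Spec.map _)
    infer_instance
  have : IsIso (toSpectrum Z ⊤ hT) :=
    (Over.isoMk (asIso (toSpectrum Z ⊤ hT).left) (Over.w _)).isIso_hom
  refine ⟨spectrumMap (hT := hT) f (fun s _ => h s) ≫ inv (toSpectrum Z ⊤ hT), ?_⟩
  rw [← Category.assoc, toSpectrum_spectrumMap, Category.assoc, IsIso.hom_inv_id,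
    Category.comp_id]

/-- The regular functions on a product of affine schemes are generated by scalars and pullbacks
from the factors. If a ring `S` contains these, the projections factor through `Spec S`, so the
universal property makes `Y` a retract of `Spec S`. -/
theorem eq_top_of_pullbacks_mem {Y : Over (Spec A₀)} {ι : Type*} {Z : ι → Over (Spec A₀)}
    (hZ : ∀ b, IsAffine (Z b).left) (p : ∀ b, Y ⟶ Z b)
    (hlift : ∀ (V : Over (Spec A₀)) (g : ∀ b, V ⟶ Z b), ∃ l : V ⟶ Y, ∀ b, l ≫ p b = g b)
    (hext : ∀ u v : Y ⟶ Y, (∀ b, u ≫ p b = v ≫ p b) → u = v)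
    (S : Subring Γ(Y.left, ⊤)) (hS : ∀ c, scalars Y c ∈ S)
    (h : ∀ b s, (p b).left.appTop.hom s ∈ S) : S = ⊤ := by
  choose g hg using fun b => exists_toSpectrum_comp_eq (hZ b) (hS := hS) (p b) (h b)
  obtain ⟨l, hl⟩ := hlift _ g
  have hid : toSpectrum Y S hS ≫ l = 𝟙 Y := hext _ _ fun b => by
    rw [Category.assoc, hl, hg, Category.id_comp]
  rw [eq_top_iff]
  intro s _
  have h1 : (toSpectrum Y S hS).left.appTop.hom (l.left.appTop.hom s) = s := by
    rw [← over_comp_appTop_apply, hid]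
    simp
  have h2 : ∀ x, (toSpectrum Y S hS).left.appTop.hom x ∈ S := by
    intro x
    have : (toSpectrum Y S hS).left.appTop =
        (Scheme.ΓSpecIso _).hom ≫ CommRingCat.ofHom S.subtype := by
      change (Y.left.toSpecΓ ≫ Spec.map _).appTop = _
      rw [Scheme.Hom.comp_appTop, Scheme.toSpecΓ_appTop, Scheme.ΓSpecIso_naturality]
    rw [this]
    exact ((Scheme.ΓSpecIso (CommRingCat.of S)).hom.hom x).2
  rw [← h1]
  exact h2 _

end Spectrum

/-! ### Images of affine schemes -/

section Image

theorem hom_ext_of_appTop_injective {X Y Z : Scheme.{0}} {t : X ⟶ Y}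
    (ht : Function.Injective t.appTop.hom) [IsAffine Z] {u v : Y ⟶ Z} (h : t ≫ u = t ≫ v) :
    u = v := by
  refine ext_of_isAffine ?_
  ext s
  refine ht ?_
  rw [← comp_appTop_apply, ← comp_appTop_apply, h]

theorem exists_comp_eq_of_range_le {X Y Z : Scheme.{0}} [IsAffine Y] [IsAffine Z] {t : X ⟶ Y}
    (ht : Function.Injective t.appTop.hom) {t' : X ⟶ Z}
    (h : t'.appTop.hom.range ≤ t.appTop.hom.range) : ∃ u : Y ⟶ Z, t ≫ u = t' := by
  have hle : ∀ s, t'.appTop.hom s ∈ t.appTop.hom.range := fun s => h ⟨s, rfl⟩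
  let e := RingEquiv.ofBijective t.appTop.hom.rangeRestrict
    ⟨fun a b hab => ht (congrArg Subtype.val hab), t.appTop.hom.rangeRestrict_surjective⟩
  let ψ : Γ(Z, ⊤) →+* Γ(Y, ⊤) :=
    e.symm.toRingHom.comp (t'.appTop.hom.codRestrict _ hle)
  have hψ : CommRingCat.ofHom ψ ≫ t.appTop = t'.appTop := by
    ext s
    have : e (ψ s) = ⟨t'.appTop.hom s, hle s⟩ := e.apply_symm_apply _
    exact congrArg Subtype.val this
  refine ⟨Y.isoSpec.hom ≫ Spec.map (CommRingCat.ofHom ψ) ≫ Z.isoSpec.inv, ?_⟩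
  rw [← Category.assoc, ← Category.assoc, Iso.comp_inv_eq]
  change (t ≫ Y.toSpecΓ) ≫ _ = t' ≫ Z.toSpecΓ
  rw [Scheme.toSpecΓ_naturality, Scheme.toSpecΓ_naturality, Category.assoc, ← Spec.map_comp, hψ]

theorem over_hom_ext_of_appTop_injective {X Y Z : Over SpecC} {t : X ⟶ Y}
    (ht : Function.Injective t.left.appTop.hom) (hZ : IsAffine Z.left) {u v : Y ⟶ Z}
    (h : t ≫ u = t ≫ v) : u = v := by
  ext1
  exact hom_ext_of_appTop_injective ht (congrArg Over.Hom.left h)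

theorem over_exists_comp_eq_of_range_le {X Y Z : Over SpecC} (hY : IsAffine Y.left)
    (hZ : IsAffine Z.left) {t : X ⟶ Y} (ht : Function.Injective t.left.appTop.hom) {t' : X ⟶ Z}
    (h : t'.left.appTop.hom.range ≤ t.left.appTop.hom.range) : ∃ u : Y ⟶ Z, t ≫ u = t' := by
  obtain ⟨u, hu⟩ := exists_comp_eq_of_range_le ht h
  refine ⟨Over.homMk u (hom_ext_of_appTop_injective ht ?_), ?_⟩
  · rw [← Category.assoc, hu, Over.w, Over.w]
  · ext1
    exact hu

/-- The image of a natural transformation to affine schemes is determined by the rings of regular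
functions on the source that extend to it; the isomorphism is natural because morphisms of affine
schemes that are injective on functions are epimorphisms for maps to affine schemes. -/
theorem exists_iso_of_range_eq {H I J : AffVar ⥤ Over SpecC} (t : H ⟶ I) (t' : H ⟶ J)
    (hI : ∀ X, IsAffine (I.obj X).left) (hJ : ∀ X, IsAffine (J.obj X).left)
    (ht : ∀ X, Function.Injective (t.app X).left.appTop.hom)
    (ht' : ∀ X, Function.Injective (t'.app X).left.appTop.hom)
    (h : ∀ X, (t.app X).left.appTop.hom.range = (t'.app X).left.appTop.hom.range) :
    ∃ e : I ≅ J, t ≫ e.hom = t' := by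
  choose u hu using fun X => over_exists_comp_eq_of_range_le (hI X) (hJ X) (ht X) (h X).ge
  choose v hv using fun X => over_exists_comp_eq_of_range_le (hJ X) (hI X) (ht' X) (h X).le
  refine ⟨NatIso.ofComponents (fun X => ⟨u X, v X, ?_, ?_⟩) fun {X Y} f => ?_, ?_⟩
  · refine over_hom_ext_of_appTop_injective (ht X) (hI X) ?_
    rw [← Category.assoc, hu, hv, Category.comp_id]
  · refine over_hom_ext_of_appTop_injective (ht' X) (hJ X) ?_
    rw [← Category.assoc, hv, hu, Category.comp_id]
  · refine over_hom_ext_of_appTop_injective (ht X) (hJ Y) ?_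
    change t.app X ≫ I.map f ≫ u Y = t.app X ≫ u X ≫ J.map f
    rw [← Category.assoc, ← t.naturality, Category.assoc, hu, t'.naturality, ← Category.assoc,
      hu]
  · ext X : 2
    exact hu X

theorem range_appTop_of_comp_eq {X Y Z : Scheme.{0}} {t : X ⟶ Y} {i : Y ⟶ Z} {f : X ⟶ Z}
    (h : t ≫ i = f) (hi : Function.Surjective i.appTop.hom) :
    t.appTop.hom.range = f.appTop.hom.range := by
  subst h
  ext s
  constructor
  · rintro ⟨y, rfl⟩
    obtain ⟨z, rfl⟩ := hi y
    exact ⟨z, comp_appTop_apply _ _ _⟩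
  · rintro ⟨z, rfl⟩
    exact ⟨_, (comp_appTop_apply _ _ _).symm⟩

theorem isAffine_imageFunctor {F G : AffVar ⥤ Over SpecC} (α : F ⟶ G) (X : AffVar)
    (hG : IsAffine (G.obj X).left) : IsAffine ((imageFunctor α).obj X).left :=
  (IsClosedImmersion.isAffine_surjective_of_isAffine (α.app X).left.imageι).1

theorem toImageFunctor_injective {F G : AffVar ⥤ Over SpecC} (α : F ⟶ G) (X : AffVar)
    (hF : IsAffine (F.obj X).left) (hG : IsAffine (G.obj X).left) :
    Function.Injective ((toImageFunctor α).app X).left.appTop.hom :=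
  Scheme.Hom.toImage_app_injective (α.app X).left ⟨⊤, isAffineOpen_top _⟩

theorem range_toImageFunctor {F G : AffVar ⥤ Over SpecC} (α : F ⟶ G) (X : AffVar)
    (hG : IsAffine (G.obj X).left) :
    ((toImageFunctor α).app X).left.appTop.hom.range = (α.app X).left.appTop.hom.range :=
  range_appTop_of_comp_eq (Scheme.Hom.toImage_imageι (α.app X).left)
    (IsClosedImmersion.isAffine_surjective_of_isAffine (α.app X).left.imageι).2

theorem ker_nilradical_le {Y Z : Scheme.{0}} [IsReduced Y] (f : Y ⟶ Z) :
    Z.nilradical.subschemeι.ker ≤ f.ker := by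
  rw [Scheme.IdealSheafData.ker_subschemeι, ← Scheme.IdealSheafData.map_bot,
    ← Scheme.nilradical_eq_bot]
  exact nilradical_le_map _

/-- A morphism from a reduced scheme to `Z`, as a morphism to `Z_red`. -/
def toReduction {S : Scheme.{0}} {Y Z : Over S} (hY : IsReduced Y.left) (f : Y ⟶ Z) :
    Y ⟶ (reduction S).obj Z :=
  Over.homMk (show Y.left ⟶ Z.left.nilradical.subscheme from
      IsClosedImmersion.lift Z.left.nilradical.subschemeι f.left (ker_nilradical_le f.left))
    ((IsClosedImmersion.lift_fac_assoc Z.left.nilradical.subschemeι f.left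
      (ker_nilradical_le f.left) Z.hom).trans (Over.w f))

theorem toReduction_reductionι {S : Scheme.{0}} {Y Z : Over S} (hY : IsReduced Y.left)
    (f : Y ⟶ Z) : toReduction hY f ≫ reductionι Z = f := by
  ext1
  exact IsClosedImmersion.lift_fac Z.left.nilradical.subschemeι f.left (ker_nilradical_le f.left)

instance {S : Scheme.{0}} (Z : Over S) : Mono (reductionι Z) := by
  have : Mono (reductionι Z).left :=
    inferInstanceAs (Mono Z.left.nilradical.subschemeι)
  exact Over.mono_of_mono_left _

theorem isAffine_reduction {S : Scheme.{0}} (Z : Over S) (hZ : IsAffine Z.left) :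
    IsAffine ((reduction S).obj Z).left :=
  (IsClosedImmersion.isAffine_surjective_of_isAffine Z.left.nilradical.subschemeι).1

theorem reduction_map_reductionι {S : Scheme.{0}} {Y Z : Over S} (f : Y ⟶ Z) :
    (reduction S).map f ≫ reductionι Z = reductionι Y ≫ f := by
  ext1
  exact Scheme.IdealSheafData.subschemeMap_subschemeι _ _ _ (nilradical_le_map f.left)

/-- A function on `Z_red` that pulls back to zero along a surjective morphism vanishes at every
point, so it is zero. -/
theorem toReduction_injective {S : Scheme.{0}} {Y Z : Over S} (hY : IsReduced Y.left) (f : Y ⟶ Z)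
    (hZ : IsAffine Z.left) (hf : Surjective f.left) :
    Function.Injective (toReduction hY f).left.appTop.hom := by
  rw [injective_iff_map_eq_zero]
  intro s hs
  obtain ⟨z, hz⟩ := (IsClosedImmersion.isAffine_surjective_of_isAffine
    Z.left.nilradical.subschemeι).2 s
  have h0 : f.left.appTop.hom z = 0 := by
    rw [← hs, ← hz]
    conv_lhs => rw [← toReduction_reductionι hY f]
    exact over_comp_appTop_apply _ _ _
  have hbot : Z.left.basicOpen z = ⊥ := by
    have h1 : f.left ⁻¹ᵁ Z.left.basicOpen z = ⊥ := by
      rw [Scheme.preimage_basicOpen_top]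
      change Y.left.basicOpen (f.left.appTop.hom z) = ⊥
      rw [h0, Scheme.basicOpen_zero]
    rw [eq_bot_iff]
    intro x hx
    obtain ⟨y, rfl⟩ := hf.surj x
    have : y ∈ f.left ⁻¹ᵁ Z.left.basicOpen z := hx
    rw [h1] at this
    exact this
  have hnil := (Scheme.isNilpotent_iff_basicOpen_eq_bot z).2 hbot
  have hmem : z ∈ Z.left.nilradical.ideal ⟨⊤, isAffineOpen_top _⟩ := by
    change z ∈ Ideal.radical _
    rw [mem_nilradical.symm] at hnil
    exact hnil
  rw [← Scheme.IdealSheafData.ker_subschemeι_app] at hmem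
  rw [← hz]
  exact hmem

theorem range_toReduction {S : Scheme.{0}} {Y Z : Over S} (hY : IsReduced Y.left) (f : Y ⟶ Z)
    (hZ : IsAffine Z.left) :
    (toReduction hY f).left.appTop.hom.range = f.left.appTop.hom.range :=
  range_appTop_of_comp_eq (congrArg Over.Hom.left (toReduction_reductionι hY f))
    (IsClosedImmersion.isAffine_surjective_of_isAffine Z.left.nilradical.subschemeι).2

end Image

/-! ### Finiteness of the ring of weighted sums -/

theorem mem_weightOpen {k r : ℕ}
    {P : Spec (CommRingCat.of (MvPolynomial (Fin k × Fin r) ℂ))} :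
    P ∈ weightOpen k r ↔ ∀ S : Finset (Fin k), S.Nonempty →
      ∃ i : Fin r, ∑ j ∈ S, MvPolynomial.X (j, i) ∉ P.asIdeal := by
  rw [weightOpen, ← SetLike.mem_coe, TopologicalSpace.Opens.coe_iInf, Set.mem_iInter]
  refine ⟨fun h S hS => ?_, fun h S => ?_⟩
  · exact TopologicalSpace.Opens.mem_iSup.1 (h ⟨S, hS⟩)
  · exact TopologicalSpace.Opens.mem_iSup.2 (h S.1 S.2)

section Finiteness

/-- The Artin-Tate lemma. -/
theorem finiteType_of_finite_of_injective {A B C : Type*} [CommRing A] [CommRing B] [CommRing C]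
    [IsNoetherianRing A] (f : A →+* B) (g : B →+* C) (hgf : (g.comp f).FiniteType) (hg : g.Finite)
    (hinj : Function.Injective g) : f.FiniteType := by
  algebraize [f, g, g.comp f]
  have h1 : (⊤ : Subalgebra A C).FG := Algebra.FiniteType.out
  have h2 : (⊤ : Submodule B C).FG := Module.Finite.fg_top
  exact ⟨fg_of_fg_of_fg A B C h1 h2 hinj⟩

variable {k r : ℕ} {A E : Type*} [CommRing A] [CommRing E]

/-- The weighted sums `∑ j, m_{j,i} f(x_j)`, where `σ` gives the coordinates `m_{j,i}` of the
weights as elements of `E`, and `pt j f` is the element `f(x_j)`. -/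
def weightedSums (σ : MvPolynomial (Fin k × Fin r) ℂ →+* E) (pt : Fin k → A →+* E) : Set E :=
  Set.range fun q : Fin r × A => ∑ j, σ (MvPolynomial.X (j, q.1)) * pt j q.2

variable (σ : MvPolynomial (Fin k × Fin r) ℂ →+* E) (pt : Fin k → A →+* E)

/-- Over a basic open set of admissible weights, the ring `E` of functions of the weights and points
is finite over its subring `R`. Indeed `∑ j, m_{j,i} f(x_j) ^ n` is a weighted sum of `f ^ n`,
so every `f(x_j)` is integral over `R`. -/
theorem finite_awayMap (R : Subring E) (hσ : ∀ c, σ c ∈ R) (hR : weightedSums σ pt ⊆ R)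
    (hE : Subring.closure (Set.range σ ∪ ⋃ j, Set.range (pt j)) = ⊤)
    (hfin : (σ.comp MvPolynomial.C).FiniteType)
    (h : MvPolynomial (Fin k × Fin r) ℂ)
    (hh : PrimeSpectrum.basicOpen h ≤ weightOpen k r) :
    (Localization.awayMap R.subtype ⟨σ h, hσ h⟩).Finite := by
  set x : R := ⟨σ h, hσ h⟩ with hx
  let σR : MvPolynomial (Fin k × Fin r) ℂ →+* R := σ.codRestrict R hσ
  let K := Localization.Away x
  let B := Localization.Away (R.subtype x)
  let φ : K →+* B := Localization.awayMap R.subtype x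
  have hφ : ∀ a : R, φ (algebraMap R K a) = algebraMap E B a := fun a => IsLocalization.map_eq _ _
  have hft : φ.FiniteType := by
    have h1 : (algebraMap E B).FiniteType := by
      rw [RingHom.finiteType_algebraMap]
      exact IsLocalization.finiteType_of_monoid_fg (Submonoid.powers (R.subtype x)) B
    have h2 : ((algebraMap E B).comp (σ.comp MvPolynomial.C)).FiniteType := h1.comp hfin
    have h3 : (algebraMap E B).comp (σ.comp MvPolynomial.C) =
        φ.comp ((algebraMap R K).comp (σR.comp MvPolynomial.C)) := by
      refine RingHom.ext fun c => ?_
      exact (hφ (σR (MvPolynomial.C c))).symm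
    rw [h3] at h2
    exact RingHom.FiniteType.of_comp_finiteType h2
  algebraize [φ]
  have hpt : ∀ j f, IsIntegral K (algebraMap E B (pt j f)) := by
    intro j f
    refine isIntegral_of_weighted_psums_mem
      (fun j i => algebraMap R K (σR (MvPolynomial.X (j, i)))) (fun S hS p hp => ?_)
      (fun j => algebraMap E B (pt j f)) (fun n i => ?_) j
    · let P : PrimeSpectrum (MvPolynomial (Fin k × Fin r) ℂ) :=
        ⟨p.comap ((algebraMap R K).comp σR), inferInstance⟩
      have hP : P ∈ PrimeSpectrum.basicOpen h := by
        intro hmem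
        exact hp.ne_top (Ideal.eq_top_of_isUnit_mem _ hmem
          (IsLocalization.Away.algebraMap_isUnit (S := K) x))
      obtain ⟨i, hi⟩ := mem_weightOpen.1 (hh hP) S hS
      refine ⟨i, fun hmem => hi ?_⟩
      change (algebraMap R K).comp σR _ ∈ p
      rw [map_sum]
      exact hmem
    · have hmem : ∑ j, σ (MvPolynomial.X (j, i)) * pt j (f ^ (n + 1)) ∈ R := hR ⟨(i, _), rfl⟩
      refine ⟨algebraMap R K ⟨_, hmem⟩, ?_⟩
      change φ _ = _
      rw [hφ, map_sum]
      refine Finset.sum_congr rfl fun j _ => ?_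
      rw [map_mul, map_pow, map_pow]
      congr 1
      exact (hφ (σR _)).symm
  have hall : ∀ e : E, IsIntegral K (algebraMap E B e) := by
    let T : Subring E := (integralClosure K B).toSubring.comap (algebraMap E B)
    have hT : T = ⊤ := by
      rw [eq_top_iff, ← hE, Subring.closure_le]
      rintro y (⟨c, rfl⟩ | hy)
      · change IsIntegral K (algebraMap E B (σR c : E))
        rw [← hφ]
        exact isIntegral_algebraMap
      · obtain ⟨j, f, rfl⟩ := Set.mem_iUnion.1 hy
        exact hpt j f
    intro e
    have : e ∈ T := hT ▸ trivial
    exact this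
  have hint : Algebra.IsIntegral K B := by
    refine ⟨fun b => ?_⟩
    obtain ⟨n, a, ha⟩ := IsLocalization.Away.surj (R.subtype x) b
    have hu := IsLocalization.Away.algebraMap_isUnit (S := K) x
    obtain ⟨u, hu⟩ := hu
    have hux : algebraMap K B (u⁻¹ : Kˣ) * algebraMap E B (R.subtype x) = 1 := by
      have : algebraMap E B (R.subtype x) = algebraMap K B u := by
        rw [hu]
        exact (hφ x).symm
      rw [this, ← map_mul, Units.inv_mul, map_one]
    have hb : b = algebraMap K B ((u⁻¹ : Kˣ) ^ n) * algebraMap E B a := by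
      rw [← ha, map_pow, mul_comm b, ← mul_assoc, ← mul_pow, hux, one_pow, one_mul]
    rw [hb]
    exact isIntegral_algebraMap.mul (hall a)
  have : Algebra.FiniteType K B := hft
  exact Algebra.IsIntegral.finite

/-- Over a basic open set of admissible weights, the subring `R` is of finite type over `ℂ`. -/
theorem finiteType_away (R : Subring E) (hσ : ∀ c, σ c ∈ R) (hR : weightedSums σ pt ⊆ R)
    (hE : Subring.closure (Set.range σ ∪ ⋃ j, Set.range (pt j)) = ⊤)
    (hfin : (σ.comp MvPolynomial.C).FiniteType)
    (h : MvPolynomial (Fin k × Fin r) ℂ)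
    (hh : PrimeSpectrum.basicOpen h ≤ weightOpen k r) :
    ((algebraMap R (Localization.Away (⟨σ h, hσ h⟩ : R))).comp
      ((σ.codRestrict R hσ).comp MvPolynomial.C)).FiniteType := by
  have hφ : ∀ a : R, Localization.awayMap R.subtype ⟨σ h, hσ h⟩ (algebraMap R _ a) =
      algebraMap E _ a := fun a => IsLocalization.map_eq _ _
  refine finiteType_of_finite_of_injective _ (Localization.awayMap R.subtype ⟨σ h, hσ h⟩) ?_
    (finite_awayMap σ pt R hσ hR hE hfin h hh) ?_
  · have h1 : (algebraMap E (Localization.Away (R.subtype ⟨σ h, hσ h⟩))).FiniteType := by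
      rw [RingHom.finiteType_algebraMap]
      exact IsLocalization.finiteType_of_monoid_fg (Submonoid.powers (R.subtype ⟨σ h, hσ h⟩)) _
    have h2 := h1.comp hfin
    have h3 : (algebraMap E (Localization.Away (R.subtype ⟨σ h, hσ h⟩))).comp
        (σ.comp MvPolynomial.C) = (Localization.awayMap R.subtype ⟨σ h, hσ h⟩).comp
          ((algebraMap R (Localization.Away (⟨σ h, hσ h⟩ : R))).comp
            ((σ.codRestrict R hσ).comp MvPolynomial.C)) := by
      refine RingHom.ext fun c => ?_
      exact (hφ (σ.codRestrict R hσ (MvPolynomial.C c))).symm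
    rwa [h3] at h2
  · have : IsLocalization ((Submonoid.powers (⟨σ h, hσ h⟩ : R)).map R.subtype)
        (Localization.Away (R.subtype ⟨σ h, hσ h⟩)) := by
      rw [Submonoid.map_powers]
      infer_instance
    exact IsLocalization.map_injective_of_injective (Submonoid.powers (⟨σ h, hσ h⟩ : R)) _ _
      Subtype.val_injective

end Finiteness

/-! ### The family over the affine space of all weights -/

/-- The polynomial ring `ℂ[m_{j,i}]`. -/
abbrev weightRing (k r : ℕ) : CommRingCat.{0} := CommRingCat.of (MvPolynomial (Fin k × Fin r) ℂ)

/-- The affine space `Spec ℂ[m_{j,i}]` of all tuples of weights, over `ℂ`. -/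
abbrev affineWeightSpace (k r : ℕ) : Over SpecC :=
  Over.mk (Spec.map (CommRingCat.ofHom (MvPolynomial.C (R := ℂ) (σ := Fin k × Fin r))))

/-- The functor `X ↦ X^k × Spec ℂ[m_{j,i}]` to schemes over `Spec ℂ[m_{j,i}]`. -/
def affineWeightedPow (k r : ℕ) : AffVar ⥤ Over (Spec (weightRing k r)) :=
  pow k ⋙ Over.pullback (affineWeightSpace k r).hom

theorem locallyOfFiniteType_pullback_fst_comp {Y Z S : Scheme.{0}} (f : Y ⟶ S) (g : Z ⟶ S)
    (hf : LocallyOfFiniteType f) (hg : LocallyOfFiniteType g) :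
    LocallyOfFiniteType (pullback.fst f g ≫ f) :=
  inferInstance

section Powers

variable (n k r : ℕ) (X : AffVar)

instance : IsAffine X.obj.left := X.property.2
instance : IsReduced X.obj.left := X.property.1.isReduced
instance : LocallyOfFiniteType X.obj.hom := X.property.1.locallyOfFiniteType

instance isAffine_pow : IsAffine ((pow n).obj X).left :=
  isAffine_piObj (fun _ : Fin n => X.obj) fun _ => inferInstance

instance isReduced_pow : IsReduced ((pow n).obj X).left :=
  isReduced_piObj (fun _ : Fin n => X.obj) (fun _ => inferInstance) (fun _ => inferInstance)
    fun _ => inferInstance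

instance locallyOfFiniteType_pow : LocallyOfFiniteType ((pow n).obj X).hom :=
  locallyOfFiniteType_piObj (fun _ : Fin n => X.obj) fun _ => inferInstance

theorem isIntegral_pow [IsIntegral X.obj.left] : IsIntegral ((pow n).obj X).left :=
  isIntegral_piObj (fun _ : Fin n => X.obj) (fun _ => inferInstance) (fun _ => inferInstance)
    fun _ => inferInstance

/-- The `j`-th projection `Xⁿ → X`. -/
def powProj (j : Fin n) : (pow n).obj X ⟶ X.obj := Limits.Pi.π (fun _ : Fin n => X.obj) j

variable {n X} in
theorem pow_map_powProj {Y : AffVar} (φ : X ⟶ Y) (j : Fin n) :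
    (pow n).map φ ≫ powProj n Y j = powProj n X j ≫ φ.hom :=
  Limits.Pi.map_π (fun _ : Fin n => φ.hom) j

variable {n k X} in
theorem reindex_powProj (σ : Fin n → Fin k) (t : Fin n) :
    (reindex σ).app X ≫ powProj n X t = powProj k X (σ t) :=
  Limits.Pi.lift_π _ _

variable {n X} in
theorem pow_eq_top (S : Subring Γ(((pow n).obj X).left, ⊤))
    (hC : ∀ c, constants ((pow n).obj X) c ∈ S)
    (h : ∀ j f, pullbackFun (powProj n X j) f ∈ S) : S = ⊤ :=
  eq_top_of_pullbacks_mem (Z := fun _ : Fin n => X.obj) (fun _ => inferInstance) (powProj n X)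
    (fun _ g => ⟨Limits.Pi.lift g, fun _ => Limits.Pi.lift_π _ _⟩)
    (fun _ _ h => Limits.Pi.hom_ext _ _ h) S hC h

instance isAffine_affineWeightSpace : IsAffine (affineWeightSpace k r).left := isAffine_Spec _

instance isReduced_affineWeightSpace : IsReduced (affineWeightSpace k r).left :=
  (affine_isReduced_iff _).2
    (inferInstanceAs (_root_.IsReduced (MvPolynomial (Fin k × Fin r) ℂ)))

instance isIntegral_affineWeightSpace : IsIntegral (affineWeightSpace k r).left :=
  (affine_isIntegral_iff _).2 (inferInstanceAs (IsDomain (MvPolynomial (Fin k × Fin r) ℂ)))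

instance locallyOfFiniteType_affineWeightSpace :
    LocallyOfFiniteType (affineWeightSpace k r).hom := by
  refine (HasRingHomProperty.Spec_iff (P := @LocallyOfFiniteType)).2 ?_
  have : (algebraMap ℂ (MvPolynomial (Fin k × Fin r) ℂ)).FiniteType :=
    RingHom.finiteType_algebraMap.2 inferInstance
  exact this

instance isAffine_affineWeightedPow : IsAffine ((affineWeightedPow k r).obj X).left :=
  inferInstanceAs (IsAffine (pullback ((pow k).obj X).hom (affineWeightSpace k r).hom))

instance isReduced_affineWeightedPow : IsReduced ((affineWeightedPow k r).obj X).left :=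
  isReduced_pullback ((pow k).obj X).hom (affineWeightSpace k r).hom

theorem isIntegral_affineWeightedPow [IsIntegral X.obj.left] :
    IsIntegral ((affineWeightedPow k r).obj X).left :=
  have := isIntegral_pow k X
  isIntegral_pullback ((pow k).obj X).hom (affineWeightSpace k r).hom

/-- The projection `X^k × Spec ℂ[m_{j,i}] → X^k`. -/
def powFst : ((affineWeightedPow k r).obj X).left ⟶ ((pow k).obj X).left :=
  pullback.fst _ _

/-- The product `X^k × Spec ℂ[m_{j,i}]` as a scheme over `ℂ`. -/
def totalOver : Over SpecC :=
  Over.mk (((affineWeightedPow k r).obj X).hom ≫ (affineWeightSpace k r).hom)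

/-- The first projection of `totalOver`, as a morphism over `ℂ`. -/
def totalFst : totalOver k r X ⟶ (pow k).obj X :=
  Over.homMk (powFst k r X) pullback.condition

/-- The second projection of `totalOver`, as a morphism over `ℂ`. -/
def totalSnd : totalOver k r X ⟶ affineWeightSpace k r :=
  Over.homMk ((affineWeightedPow k r).obj X).hom rfl

/-- The function `f(x_j)` on `X^k × Spec ℂ[m_{j,i}]`, for a function `f` on `X`. -/
def coordFun (j : Fin k) : Γ(X.obj.left, ⊤) →+* Γ(((affineWeightedPow k r).obj X).left, ⊤) :=
  (powFst k r X).appTop.hom.comp (pullbackFun (powProj k X j))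

theorem scalars_C (c : ℂ) : scalars ((affineWeightedPow k r).obj X) (MvPolynomial.C c) =
    constants (totalOver k r X) c := by
  have h : CommRingCat.ofHom (MvPolynomial.C (R := ℂ) (σ := Fin k × Fin r)) ≫
      (Scheme.ΓSpecIso (weightRing k r)).inv = (Scheme.ΓSpecIso (CommRingCat.of ℂ)).inv ≫
        (Spec.map (CommRingCat.ofHom MvPolynomial.C)).appTop :=
    Scheme.ΓSpecIso_inv_naturality _
  have := congrArg (fun u => (u ≫ ((affineWeightedPow k r).obj X).hom.appTop).hom c) h
  refine this.trans ?_
  change _ = ((Scheme.ΓSpecIso (CommRingCat.of ℂ)).inv ≫ (((affineWeightedPow k r).obj X).hom ≫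
    (affineWeightSpace k r).hom).appTop).hom c
  rw [Scheme.Hom.comp_appTop]
  rfl

variable {k r X} in
theorem affineWeightedPow_eq_top (S : Subring Γ(((affineWeightedPow k r).obj X).left, ⊤))
    (hC : ∀ c, scalars ((affineWeightedPow k r).obj X) c ∈ S)
    (h : ∀ j f, coordFun k r X j f ∈ S) : S = ⊤ := by
  have hS : ∀ c, constants (totalOver k r X) c ∈ S := fun c => by
    rw [← scalars_C]
    exact hC _
  refine eq_top_of_pullbacks_mem (Y := totalOver k r X) (ι := Bool)
    (Z := fun b => if b then affineWeightSpace k r else (pow k).obj X)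
    (by
      rintro (_ | _)
      · exact isAffine_pow k X
      · exact isAffine_Spec _)
    (fun b => match b with
      | true => totalSnd k r X
      | false => totalFst k r X)
    (fun V g => ⟨Over.homMk (pullback.lift (g false).left (g true).left
      ((Over.w (g false)).trans (Over.w (g true)).symm)) ?_, ?_⟩) (fun u v huv => ?_) S hS ?_
  · change pullback.lift _ _ _ ≫ pullback.snd _ _ ≫ _ = _
    rw [pullback.lift_snd_assoc]
    exact Over.w (g true)
  · rintro (_ | _)
    · ext1
      exact pullback.lift_fst _ _ _
    · ext1
      exact pullback.lift_snd _ _ _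
  · ext1
    exact pullback.hom_ext (congrArg Over.Hom.left (huv false))
      (congrArg Over.Hom.left (huv true))
  · rintro (_ | _) s
    · have : S.comap (powFst k r X).appTop.hom = ⊤ := by
        refine pow_eq_top _ (fun c => ?_) fun j f => h j f
        have := pullbackFun_constants (totalFst k r X) c
        rw [Subring.mem_comap]
        exact this ▸ hS c
      have hs : s ∈ S.comap (powFst k r X).appTop.hom := this ▸ trivial
      exact hs
    · obtain ⟨c, rfl⟩ : ∃ c, (Scheme.ΓSpecIso (weightRing k r)).inv.hom c = s :=
        ⟨(Scheme.ΓSpecIso (weightRing k r)).hom.hom s, by simp⟩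
      exact hC c

theorem finiteType_scalars_C :
    ((scalars ((affineWeightedPow k r).obj X)).comp MvPolynomial.C).FiniteType := by
  have h : (scalars ((affineWeightedPow k r).obj X)).comp MvPolynomial.C =
      constants (totalOver k r X) := RingHom.ext (scalars_C k r X)
  rw [h]
  have h1 : LocallyOfFiniteType (totalOver k r X).hom := by
    have : (totalOver k r X).hom = pullback.fst ((pow k).obj X).hom (affineWeightSpace k r).hom ≫
        ((pow k).obj X).hom := pullback.condition.symm
    rw [this]
    exact locallyOfFiniteType_pullback_fst_comp _ _ (locallyOfFiniteType_pow k X)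
      (locallyOfFiniteType_affineWeightSpace k r)
  have : IsAffine (totalOver k r X).left := isAffine_affineWeightedPow k r X
  have h2 := HasRingHomProperty.appTop @LocallyOfFiniteType _ h1
  exact h2.comp (RingHom.FiniteType.of_surjective _
    (ConcreteCategory.bijective_of_isIso (Scheme.ΓSpecIso (CommRingCat.of ℂ)).inv).2)

/-- The ring of functions on `X^k × Spec ℂ[m_{j,i}]` generated by the polynomials in the weights and
the weighted sums `∑ j, m_{j,i} f(x_j)`. -/
def weightedRing : Subring Γ(((affineWeightedPow k r).obj X).left, ⊤) :=
  Subring.closure (Set.range (scalars ((affineWeightedPow k r).obj X)) ∪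
    weightedSums (scalars ((affineWeightedPow k r).obj X)) (coordFun k r X))

theorem scalars_mem_weightedRing (c : weightRing k r) :
    scalars ((affineWeightedPow k r).obj X) c ∈ weightedRing k r X :=
  Subring.subset_closure (Or.inl ⟨c, rfl⟩)

variable {X} in
theorem map_coordFun {Y : AffVar} (φ : X ⟶ Y) (j : Fin k) (f : Γ(Y.obj.left, ⊤)) :
    ((affineWeightedPow k r).map φ).left.appTop.hom (coordFun k r Y j f) =
      coordFun k r X j (pullbackFun φ.hom f) := by
  have h : ((affineWeightedPow k r).map φ).left ≫ powFst k r Y =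
      powFst k r X ≫ ((pow k).map φ).left := pullback.lift_fst _ _ _
  change ((affineWeightedPow k r).map φ).left.appTop.hom ((powFst k r Y).appTop.hom _) =
    (powFst k r X).appTop.hom _
  rw [← comp_appTop_apply, h, comp_appTop_apply]
  congr 1
  rw [← pullbackFun_comp, pow_map_powProj, pullbackFun_comp]

variable {X} in
theorem map_mem_weightedRing {Y : AffVar} (φ : X ⟶ Y)
    (s : Γ(((affineWeightedPow k r).obj Y).left, ⊤)) (hs : s ∈ weightedRing k r Y) :
    ((affineWeightedPow k r).map φ).left.appTop.hom s ∈ weightedRing k r X := by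
  change s ∈ (weightedRing k r X).comap _
  revert s
  change weightedRing k r Y ≤ _
  refine Subring.closure_le.2 ?_
  rintro _ (⟨c, rfl⟩ | ⟨⟨i, f⟩, rfl⟩)
  · change _ ∈ weightedRing k r X
    rw [appTop_scalars]
    exact scalars_mem_weightedRing k r X c
  · refine Subring.subset_closure (Or.inr ⟨(i, pullbackFun φ.hom f), ?_⟩)
    simp only [map_sum, map_mul, map_coordFun]
    exact Finset.sum_congr rfl fun j _ => congrArg (· * _) (appTop_scalars _ _).symm

end Powers

section Family

theorem appTop_toSpectrum {A₀ : CommRingCat.{0}} (Y : Over (Spec A₀))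
    (S : Subring Γ(Y.left, ⊤)) (hS : ∀ c, scalars Y c ∈ S) : (toSpectrum Y S hS).left.appTop =
      (Scheme.ΓSpecIso (CommRingCat.of S)).hom ≫ CommRingCat.ofHom S.subtype := by
  change (Y.left.toSpecΓ ≫ Spec.map _).appTop = _
  rw [Scheme.Hom.comp_appTop, Scheme.toSpecΓ_appTop, Scheme.ΓSpecIso_naturality]

theorem toSpectrum_injective {A₀ : CommRingCat.{0}} (Y : Over (Spec A₀))
    (S : Subring Γ(Y.left, ⊤)) (hS : ∀ c, scalars Y c ∈ S) :
    Function.Injective (toSpectrum Y S hS).left.appTop.hom := by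
  rw [appTop_toSpectrum]
  exact Subtype.val_injective.comp
    (ConcreteCategory.bijective_of_isIso (Scheme.ΓSpecIso (CommRingCat.of S)).hom).1

theorem range_toSpectrum {A₀ : CommRingCat.{0}} (Y : Over (Spec A₀))
    (S : Subring Γ(Y.left, ⊤)) (hS : ∀ c, scalars Y c ∈ S) :
    (toSpectrum Y S hS).left.appTop.hom.range = S := by
  rw [appTop_toSpectrum]
  ext s
  constructor
  · rintro ⟨x, rfl⟩
    exact ((Scheme.ΓSpecIso (CommRingCat.of S)).hom.hom x).2
  · intro hs
    obtain ⟨x, hx⟩ :=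
      (ConcreteCategory.bijective_of_isIso (Scheme.ΓSpecIso (CommRingCat.of S)).hom).2 ⟨s, hs⟩
    exact ⟨x, congrArg Subtype.val hx⟩

theorem spectrum_hom_ext {A₀ : CommRingCat.{0}} {Y Z : Over (Spec A₀)}
    {S : Subring Γ(Y.left, ⊤)} {hS : ∀ c, scalars Y c ∈ S} (hZ : IsAffine Z.left)
    {u v : spectrum Y S hS ⟶ Z} (h : toSpectrum Y S hS ≫ u = toSpectrum Y S hS ≫ v) : u = v := by
  ext1
  exact hom_ext_of_appTop_injective (toSpectrum_injective Y S hS) (congrArg Over.Hom.left h)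

instance isAffine_spectrum {A₀ : CommRingCat.{0}} (Y : Over (Spec A₀))
    (S : Subring Γ(Y.left, ⊤)) (hS : ∀ c, scalars Y c ∈ S) : IsAffine (spectrum Y S hS).left :=
  isAffine_Spec _

/-- The functor `X ↦ Spec R(X)`, where `R(X)` is the ring `weightedRing` of functions on
`X^k × Spec ℂ[m_{j,i}]`. -/
def affineFamily (k r : ℕ) : AffVar ⥤ Over (Spec (weightRing k r)) where
  obj X := spectrum ((affineWeightedPow k r).obj X) (weightedRing k r X)
    (scalars_mem_weightedRing k r X)
  map φ := spectrumMap ((affineWeightedPow k r).map φ) (map_mem_weightedRing k r φ)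
  map_id X := spectrum_hom_ext (isAffine_spectrum _ _ _) (by
    rw [toSpectrum_spectrumMap, CategoryTheory.Functor.map_id, Category.id_comp, Category.comp_id])
  map_comp φ ψ := spectrum_hom_ext (isAffine_spectrum _ _ _) (by
    rw [toSpectrum_spectrumMap, ← Category.assoc, toSpectrum_spectrumMap, Category.assoc,
      toSpectrum_spectrumMap, Functor.map_comp, Category.assoc])

/-- The morphism `X^k × Spec ℂ[m_{j,i}] → Spec R(X)`. -/
def affineQuot (k r : ℕ) : affineWeightedPow k r ⟶ affineFamily k r where
  app _ := toSpectrum _ _ _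
  naturality _ _ φ := (toSpectrum_spectrumMap ((affineWeightedPow k r).map φ) _).symm

/-- Pullback along `g` and then along `f` is pullback along `f ≫ g`, by the canonical isomorphism of
iterated fiber products. -/
def pullbackCompIso {S T U : Scheme.{0}} (f : S ⟶ T) (g : T ⟶ U) :
    Over.pullback g ⋙ Over.pullback f ≅ Over.pullback (f ≫ g) :=
  NatIso.ofComponents
    (fun Y => Over.isoMk (pullbackLeftPullbackSndIso Y.hom g f)
      (pullbackLeftPullbackSndIso_hom_snd _ _ _))
    (fun φ => by
      ext1
      refine pullback.hom_ext ?_ ?_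
      · refine (Category.assoc _ _ _).trans ((congrArg (_ ≫ ·)
          (pullbackLeftPullbackSndIso_hom_fst _ _ _)).trans ?_)
        refine (pullback.lift_fst_assoc _ _ _ _).trans ?_
        refine Eq.trans ?_ (Category.assoc _ _ _).symm
        refine Eq.trans ?_ (congrArg (_ ≫ ·) (pullback.lift_fst _ _ _)).symm
        refine Eq.trans ?_ (pullbackLeftPullbackSndIso_hom_fst_assoc _ _ _ _).symm
        exact (Category.assoc _ _ _).trans (congrArg (_ ≫ ·) (pullback.lift_fst _ _ _))
      · refine (Category.assoc _ _ _).trans ((congrArg (_ ≫ ·)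
          (pullbackLeftPullbackSndIso_hom_snd _ _ _)).trans ?_)
        refine (pullback.lift_snd _ _ _).trans ?_
        refine Eq.trans ?_ (Category.assoc _ _ _).symm
        refine Eq.trans ?_ (congrArg (_ ≫ ·) (pullback.lift_snd _ _ _)).symm
        exact (pullbackLeftPullbackSndIso_hom_snd _ _ _).symm)

/-- The family `Δ^{k,r}(X)` over `((ℂ^r)^k)°`: the restriction of `Spec R(X)` to the open subset of
admissible weights. -/
def family (k r : ℕ) : AffVar ⥤ Over (weightSpace k r).left :=
  affineFamily k r ⋙ Over.pullback (weightOpen k r).ι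

/-- The morphism `q : ((ℂ^r)^k)° × X^k → Δ^{k,r}(X)`: the restriction of `affineQuot`. -/
def familyQuot (k r : ℕ) : weightedPow k r ⟶ family k r :=
  Functor.whiskerLeft (pow k)
      (pullbackCompIso (weightOpen k r).ι (affineWeightSpace k r).hom).inv ≫
    Functor.whiskerRight (affineQuot k r) (Over.pullback (weightOpen k r).ι)

end Family

/-! ### Finiteness and geometry of the family -/

section Geometry

/-- Instance search does not unify the arguments of Mathlib's instance for affine-local properties,
so it is applied to the affine criterion for finiteness by hand. -/
instance isZariskiLocalAtTarget_isFinite : IsZariskiLocalAtTarget (@IsFinite.{0}) :=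
  @HasAffineProperty.instIsZariskiLocalAtTarget _ _
    IsFinite.instHasAffinePropertyAndIsAffineFiniteCarrierObjOppositeOpensCarrierCarrierCommRingCatPresheafOpOpensTopHomAppTop

instance respectsIso_isFinite : MorphismProperty.RespectsIso (@IsFinite.{0}) :=
  MorphismProperty.respectsIso_of_isStableUnderComposition fun _ _ _ (_ : IsIso _) => inferInstance

instance isZariskiLocalAtSource_locallyOfFiniteType :
    IsZariskiLocalAtSource (@LocallyOfFiniteType.{0}) :=
  @HasRingHomProperty.instIsZariskiLocalAtSource _ _
    instHasRingHomPropertyLocallyOfFiniteTypeFiniteType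

theorem isOpenImmersion_pullback_fst {Y Z S : Scheme.{0}} (f : Y ⟶ S) (g : Z ⟶ S)
    (hg : IsOpenImmersion g) : IsOpenImmersion (pullback.fst f g) :=
  inferInstance

theorem isAffineHom_pullback_snd {Y Z S : Scheme.{0}} (f : Y ⟶ S) (g : Z ⟶ S)
    (hf : IsAffineHom f) : IsAffineHom (pullback.snd f g) :=
  isAffineHom_isStableUnderBaseChange.of_isPullback (IsPullback.of_hasPullback f g) hf

theorem isPullback_overPullback_map {S T : Scheme.{0}} (g : S ⟶ T) {Y Z : Over T} (φ : Y ⟶ Z) :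
    IsPullback (pullback.fst Y.hom g) ((Over.pullback g).map φ).left φ.left
      (pullback.fst Z.hom g) := by
  have h1 : IsPullback (pullback.fst Y.hom g) (((Over.pullback g).map φ).left ≫
      pullback.snd Z.hom g) (φ.left ≫ Z.hom) g := by
    have e1 : ((Over.pullback g).map φ).left ≫ pullback.snd Z.hom g = pullback.snd Y.hom g :=
      pullback.lift_snd _ _ _
    rw [e1, Over.w φ]
    exact IsPullback.of_hasPullback _ _
  exact IsPullback.of_bot h1 (pullback.lift_fst _ _ _).symm (IsPullback.of_hasPullback _ _)

theorem exists_basicOpen_le {A₀ : CommRingCat.{0}} {O : (Spec A₀).Opens} {x : Spec A₀}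
    (hx : x ∈ O) : ∃ h : A₀, x ∈ PrimeSpectrum.basicOpen h ∧ PrimeSpectrum.basicOpen h ≤ O := by
  obtain ⟨_, ⟨h, rfl⟩, hxh, hO⟩ :=
    TopologicalSpace.Opens.isBasis_iff_nbhd.1 PrimeSpectrum.isBasis_basic_opens hx
  exact ⟨h, hxh, hO⟩

/-- A property local at the target can be checked for the restriction of `φ` to an open subset `O`
of the affine base on the basic open sets contained in `O`. -/
theorem overPullback_map_of_restrict {P : MorphismProperty Scheme.{0}} [IsZariskiLocalAtTarget P]
    [P.IsStableUnderBaseChange] {A₀ : CommRingCat.{0}} (O : (Spec A₀).Opens)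
    {Y Z : Over (Spec A₀)} (φ : Y ⟶ Z)
    (H : ∀ h : A₀, PrimeSpectrum.basicOpen h ≤ O →
      P (φ.left ∣_ (Z.hom ⁻¹ᵁ PrimeSpectrum.basicOpen h))) :
    P ((Over.pullback O.ι).map φ).left := by
  refine IsZariskiLocalAtTarget.of_forall_exists_morphismRestrict fun z => ?_
  let p : ((Over.pullback O.ι).obj Z).left ⟶ Z.left := pullback.fst Z.hom O.ι
  have hpc : p ≫ Z.hom = ((Over.pullback O.ι).obj Z).hom ≫ O.ι := pullback.condition
  have hz : Z.hom (p z) ∈ O := by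
    rw [← Scheme.Hom.comp_apply, hpc, Scheme.Hom.comp_apply]
    exact (((Over.pullback O.ι).obj Z).hom z).2
  obtain ⟨h, hzh, hO⟩ := exists_basicOpen_le hz
  refine ⟨p ⁻¹ᵁ (Z.hom ⁻¹ᵁ PrimeSpectrum.basicOpen h), hzh, ?_⟩
  have h1 := (isPullback_morphismRestrict ((Over.pullback O.ι).map φ).left
    (p ⁻¹ᵁ (Z.hom ⁻¹ᵁ PrimeSpectrum.basicOpen h))).flip.paste_horiz
      (isPullback_overPullback_map O.ι φ)
  have h2 := (isPullback_morphismRestrict φ.left (Z.hom ⁻¹ᵁ PrimeSpectrum.basicOpen h)).flip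
  rw [← morphismRestrict_ι] at h1
  exact P.of_isPullback (IsPullback.of_right' h1 h2) (H h hO)

theorem morphismRestrict_comp_of_isIso {P : MorphismProperty Scheme.{0}} [P.RespectsIso]
    {Y Y' Z : Scheme.{0}} (i : Y ⟶ Y') [IsIso i] (f : Y' ⟶ Z) (U : Z.Opens) (h : P (f ∣_ U)) :
    P ((i ≫ f) ∣_ U) := by
  have hi : ∀ V : Y'.Opens, IsIso (i ∣_ V) := fun V => inferInstance
  have := hi (f ⁻¹ᵁ U)
  rw [morphismRestrict_comp]
  exact (@MorphismProperty.cancel_left_of_respectsIso _ _ P _ _ _ _ (i ∣_ f ⁻¹ᵁ U) (f ∣_ U)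
    this).2 h

theorem toSpectrum_restrict {P : MorphismProperty Scheme.{0}} [P.RespectsIso]
    {A₀ : CommRingCat.{0}} (Y : Over (Spec A₀)) (hY : IsAffine Y.left)
    (S : Subring Γ(Y.left, ⊤)) (hS : ∀ c, scalars Y c ∈ S) (h : A₀)
    (H : P (Spec.map (CommRingCat.ofHom (Localization.awayMap S.subtype ⟨_, hS h⟩)))) :
    P ((toSpectrum Y S hS).left ∣_ ((spectrum Y S hS).hom ⁻¹ᵁ PrimeSpectrum.basicOpen h)) :=
  morphismRestrict_comp_of_isIso Y.left.toSpecΓ (Spec.map (CommRingCat.ofHom S.subtype)) _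
    ((P.arrow_mk_iso_iff (SpecMapRestrictBasicOpenIso (CommRingCat.ofHom S.subtype)
      ⟨_, hS h⟩)).2 H)

/-- The restriction of `Z` to an open subset `O` of the affine base is locally of finite type if
it is so over the basic open sets contained in `O`. -/
theorem locallyOfFiniteType_overPullback {A₀ : CommRingCat.{0}} (O : (Spec A₀).Opens)
    (Z : Over (Spec A₀)) {T : Scheme.{0}} (g : Spec A₀ ⟶ T)
    (H : ∀ h : A₀, PrimeSpectrum.basicOpen h ≤ O →
      LocallyOfFiniteType ((Z.hom ⁻¹ᵁ PrimeSpectrum.basicOpen h).ι ≫ Z.hom ≫ g)) :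
    LocallyOfFiniteType (((Over.pullback O.ι).obj Z).hom ≫ O.ι ≫ g) := by
  let p : ((Over.pullback O.ι).obj Z).left ⟶ Z.left := pullback.fst Z.hom O.ι
  have hp : IsOpenImmersion p := isOpenImmersion_pullback_fst Z.hom O.ι inferInstance
  have hpc : p ≫ Z.hom = ((Over.pullback O.ι).obj Z).hom ≫ O.ι := pullback.condition
  have key : ∀ z, ∃ h : A₀, z ∈ p ⁻¹ᵁ (Z.hom ⁻¹ᵁ PrimeSpectrum.basicOpen h) ∧
      PrimeSpectrum.basicOpen h ≤ O := fun z => by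
    have hz : Z.hom (p z) ∈ O := by
      rw [← Scheme.Hom.comp_apply, hpc, Scheme.Hom.comp_apply]
      exact (((Over.pullback O.ι).obj Z).hom z).2
    exact exists_basicOpen_le hz
  choose h hz hO using key
  refine IsZariskiLocalAtSource.of_iSup_eq_top (P := @LocallyOfFiniteType)
    (fun z => p ⁻¹ᵁ (Z.hom ⁻¹ᵁ PrimeSpectrum.basicOpen (h z)))
    (top_le_iff.1 fun z _ => TopologicalSpace.Opens.mem_iSup.2 ⟨z, hz z⟩) fun z => ?_
  rw [← Category.assoc _ O.ι, ← hpc, Category.assoc, ← morphismRestrict_ι_assoc]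
  exact IsZariskiLocalAtSource.comp (P := @LocallyOfFiniteType) (H (h z) (hO z)) _

theorem SpecMap_surjective {A B : Type} [CommRing A] [CommRing B] (f : A →+* B)
    (hf : f.IsIntegral) (hi : Function.Injective f) :
    Surjective (Spec.map (CommRingCat.ofHom f)) :=
  ⟨hf.comap_surjective hi⟩

variable (k r : ℕ) (X : AffVar)

theorem weightedSums_subset :
    weightedSums (scalars ((affineWeightedPow k r).obj X)) (coordFun k r X) ⊆
      weightedRing k r X :=
  fun _ hs => Subring.subset_closure (Or.inr hs)

theorem closure_coordFun : Subring.closure (Set.range (scalars ((affineWeightedPow k r).obj X)) ∪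
    ⋃ j, Set.range (coordFun k r X j)) = ⊤ :=
  affineWeightedPow_eq_top _ (fun c => Subring.subset_closure (Or.inl ⟨c, rfl⟩)) fun j f =>
    Subring.subset_closure (Or.inr (Set.mem_iUnion.2 ⟨j, f, rfl⟩))

theorem finite_awayMap_weightedRing (h : weightRing k r)
    (hh : PrimeSpectrum.basicOpen h ≤ weightOpen k r) :
    (Localization.awayMap (weightedRing k r X).subtype
      ⟨_, scalars_mem_weightedRing k r X h⟩).Finite :=
  finite_awayMap _ _ _ (scalars_mem_weightedRing k r X) (weightedSums_subset k r X)
    (closure_coordFun k r X) (finiteType_scalars_C k r X) h hh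

theorem isFinite_map_affineQuot :
    IsFinite ((Over.pullback (weightOpen k r).ι).map ((affineQuot k r).app X)).left :=
  overPullback_map_of_restrict (P := @IsFinite) _ _ fun h hh =>
    toSpectrum_restrict _ (isAffine_affineWeightedPow k r X) _ _ h
      ((IsFinite.SpecMap_iff _).2 (finite_awayMap_weightedRing k r X h hh))

theorem surjective_map_affineQuot :
    Surjective ((Over.pullback (weightOpen k r).ι).map ((affineQuot k r).app X)).left :=
  overPullback_map_of_restrict (P := @Surjective) _ _ fun h hh =>
    toSpectrum_restrict _ (isAffine_affineWeightedPow k r X) _ _ h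
      (SpecMap_surjective _ (finite_awayMap_weightedRing k r X h hh).to_isIntegral (by
        have : IsLocalization ((Submonoid.powers (⟨_, scalars_mem_weightedRing k r X h⟩ :
            weightedRing k r X)).map (weightedRing k r X).subtype)
            (Localization.Away ((weightedRing k r X).subtype
              ⟨_, scalars_mem_weightedRing k r X h⟩)) := by
          rw [Submonoid.map_powers]
          infer_instance
        exact IsLocalization.map_injective_of_injective
          (Submonoid.powers (⟨_, scalars_mem_weightedRing k r X h⟩ : weightedRing k r X)) _ _
          Subtype.val_injective))

theorem familyQuot_app_left : ∃ i : ((weightedPow k r).obj X).left ≅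
      ((Over.pullback (weightOpen k r).ι).obj ((affineWeightedPow k r).obj X)).left,
    ((familyQuot k r).app X).left =
      i.hom ≫ ((Over.pullback (weightOpen k r).ι).map ((affineQuot k r).app X)).left :=
  ⟨(Over.forget _).mapIso ((pullbackCompIso (weightOpen k r).ι (affineWeightSpace k r).hom).app
    ((pow k).obj X)).symm, rfl⟩

theorem isFinite_familyQuot : IsFinite ((familyQuot k r).app X).left := by
  obtain ⟨i, hi⟩ := familyQuot_app_left k r X
  have := isFinite_map_affineQuot k r X
  rw [hi]
  exact (MorphismProperty.cancel_left_of_respectsIso @IsFinite i.hom _).2 this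

theorem surjective_familyQuot : Surjective ((familyQuot k r).app X).left := by
  obtain ⟨i, hi⟩ := familyQuot_app_left k r X
  have := surjective_map_affineQuot k r X
  rw [hi]
  exact (MorphismProperty.cancel_left_of_respectsIso @Surjective i.hom _).2 this

theorem isAffineHom_family : IsAffineHom ((family k r).obj X).hom := by
  have h : IsAffineHom ((affineFamily k r).obj X).hom :=
    inferInstanceAs (IsAffineHom (Spec.map _))
  exact isAffineHom_pullback_snd _ _ h

/-- For `r = 1` the admissible weights form a basic open set. -/
theorem isAffine_weightSpace : IsAffine (weightSpace k 1).left := by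
  have h : weightOpen k 1 = PrimeSpectrum.basicOpen (∏ S : {S : Finset (Fin k) // S.Nonempty},
      ∑ j ∈ S.1, MvPolynomial.X (j, 0)) := by
    ext P
    refine mem_weightOpen.trans ?_
    change _ ↔ (∏ S : {S : Finset (Fin k) // S.Nonempty}, _) ∉ P.asIdeal
    rw [P.2.prod_mem_iff]
    simp
  change IsAffine (weightOpen k 1)
  rw [h]
  exact (IsAffineOpen.Spec_basicOpen _)

theorem isAffine_family : IsAffine ((family k 1).obj X).left := by
  have := isAffineHom_family k 1 X
  have := isAffine_weightSpace k
  exact isAffine_of_isAffineHom ((family k 1).obj X).hom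

theorem irreducibleSpace_family (hr : 0 < r) [IrreducibleSpace X.obj.left] :
    IrreducibleSpace ((family k r).obj X).left := by
  have : IsIntegral X.obj.left := isIntegral_of_irreducibleSpace_of_isReduced _
  have := isIntegral_affineWeightedPow k r X
  let p : ((Over.pullback (weightOpen k r).ι).obj ((affineWeightedPow k r).obj X)).left ⟶
    ((affineWeightedPow k r).obj X).left := pullback.fst _ _
  have hp : IsOpenImmersion p := isOpenImmersion_pullback_fst _ _ inferInstance
  -- the weights that are all equal to `1` are admissible, as `r > 0`
  have hm : ∀ j : Fin k, (fun _ : Fin r => 1 : Fin r → ℕ) ≠ 0 := fun j h =>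
    one_ne_zero (congrFun h ⟨0, hr⟩)
  obtain ⟨x⟩ : Nonempty ((pow k).obj X).left := (isIntegral_pow k X).nonempty
  obtain ⟨i, -⟩ := familyQuot_app_left k r X
  have hne : Nonempty
      ((Over.pullback (weightOpen k r).ι).obj ((affineWeightedPow k r).obj X)).left :=
    ⟨i.hom (pullback.fst ((weightedPow k r).obj X).hom _
      ((toFiber _ (natWeights_sum_ne_zero (fun _ _ => 1) hm) X).left x))⟩
  have := isIntegral_of_isOpenImmersion p
  have hs := surjective_map_affineQuot k r X
  exact hs.surj.irreducibleSpace
    ((Over.pullback (weightOpen k r).ι).map ((affineQuot k r).app X)).left.continuous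

theorem isVariety_family :
    IsVariety ((Over.map (weightSpace k r).hom).obj ((family k r).obj X)) where
  isReduced := by
    have hW : _root_.IsReduced Γ(((affineWeightedPow k r).obj X).left, ⊤) := inferInstance
    have hR : _root_.IsReduced (weightedRing k r X) :=
      isReduced_of_injective (weightedRing k r X).subtype Subtype.val_injective
    have : IsReduced ((affineFamily k r).obj X).left := (affine_isReduced_iff _).2 hR
    let p : ((Over.pullback (weightOpen k r).ι).obj ((affineFamily k r).obj X)).left ⟶
      ((affineFamily k r).obj X).left := pullback.fst _ _
    exact @isReduced_of_isOpenImmersion _ _ p (isOpenImmersion_pullback_fst _ _ inferInstance) _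
  isSeparated := by
    have := isAffineHom_family k r X
    change IsSeparated (((family k r).obj X).hom ≫ ((weightOpen k r).ι ≫ Spec.map _))
    have h : IsSeparated ((weightOpen k r).ι ≫
      Spec.map (CommRingCat.ofHom (MvPolynomial.C (R := ℂ) (σ := Fin k × Fin r)))) := inferInstance
    exact MorphismProperty.comp_mem @IsSeparated _ _ inferInstance h
  locallyOfFiniteType := by
    refine locallyOfFiniteType_overPullback (weightOpen k r) ((affineFamily k r).obj X)
      (Spec.map (CommRingCat.ofHom MvPolynomial.C)) fun h hh => ?_
    have h1 := finiteType_away _ _ _ (scalars_mem_weightedRing k r X) (weightedSums_subset k r X)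
      (closure_coordFun k r X) (finiteType_scalars_C k r X) h hh
    have h2 := (HasRingHomProperty.Spec_iff (P := @LocallyOfFiniteType)
      (φ := CommRingCat.ofHom _)).2 h1
    rw [CommRingCat.ofHom_comp, CommRingCat.ofHom_comp, Spec.map_comp, Spec.map_comp] at h2
    have h3 := IsZariskiLocalAtSource.comp (P := @LocallyOfFiniteType) h2
      (basicOpenIsoSpecAway (R := CommRingCat.of (weightedRing k r X))
        ⟨_, scalars_mem_weightedRing k r X h⟩).hom
    rw [← Category.assoc] at h3
    erw [basicOpenIsoSpecAway_hom_SpecMap] at h3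
    exact h3
  quasiCompact := by
    have := isAffineHom_family k r X
    have : QuasiCompact ((weightOpen k r).ι ≫
      Spec.map (CommRingCat.ofHom (MvPolynomial.C (R := ℂ) (σ := Fin k × Fin r)))) := by
      infer_instance
    exact MorphismProperty.comp_mem @QuasiCompact _ _ inferInstance this

end Geometry

/-! ### Regular functions on incidence strata -/

variable {k r : ℕ} (m : Fin k → Fin r → ℕ) (X : AffVar)

/-- The ring of functions on `X^k` generated by the constants and the weighted sums
`∑ j, (m_j)_i f(x_j)`. -/
def natWeightedRing : Subring Γ(((pow k).obj X).left, ⊤) :=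
  Subring.closure (Set.range (constants ((pow k).obj X)) ∪
    Set.range fun q : Fin r × Γ(X.obj.left, ⊤) =>
      ∑ j, (m j q.1 : Γ(((pow k).obj X).left, ⊤)) * pullbackFun (powProj k X j) q.2)

theorem constants_mem_natWeightedRing (c : ℂ) :
    constants ((pow k).obj X) c ∈ natWeightedRing m X :=
  Subring.subset_closure (Or.inl ⟨c, rfl⟩)

section Stratum

theorem sum_finSigmaFinEquiv {M : Type*} [NonAssocSemiring M] (d : Fin k → ℕ) (F : Fin k → M) :
    ∑ t, F ((finSigmaFinEquiv (n := d)).symm t).1 = ∑ j, (d j : M) * F j := by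
  rw [Equiv.sum_comp (finSigmaFinEquiv (n := d)).symm fun x => F x.1, Fintype.sum_sigma]
  simp

/-- The projection to the `i`-th symmetric power. -/
def symProj {d : Fin r → ℕ} (i : Fin r) : (symProd d).obj X ⟶ (sym (d i)).obj X :=
  Limits.Pi.π (fun i => (sym (d i)).obj X) i

theorem incidenceMap_symProj (i : Fin r) : (incidenceMap m).app X ≫ symProj X i =
    (reindex fun t => (finSigmaFinEquiv (n := fun j => m j i)).symm t |>.1).app X ≫
      (symQuot (∑ j, m j i)).app X :=
  Limits.Pi.lift_π _ _

theorem isAffine_sym (n : ℕ) : IsAffine ((sym n).obj X).left := isAffine_Spec _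

theorem isAffine_symProd (d : Fin r → ℕ) : IsAffine ((symProd d).obj X).left :=
  isAffine_piObj (fun i => (sym (d i)).obj X) fun i => isAffine_sym X (d i)

theorem range_symQuot (n : ℕ) :
    (pullbackFun ((symQuot n).app X)).range = invariants n X :=
  range_toSpectrum ((pow n).obj X) (invariants n X) fun c =>
    mem_invariants.2 fun _ => pullbackFun_constants _ c

/-- The invariant functions on `Xⁿ` are generated by constants and power sums `∑ t, f(x_t)`. -/
theorem invariants_le {n : ℕ} (P : Subring Γ(((pow n).obj X).left, ⊤))
    (hC : ∀ c, constants ((pow n).obj X) c ∈ P)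
    (h : ∀ f, ∑ t, pullbackFun (powProj n X t) f ∈ P) : invariants n X ≤ P := by
  intro s hs
  let _ : Algebra ℚ Γ(((pow n).obj X).left, ⊤) :=
    ((constants ((pow n).obj X)).comp (algebraMap ℚ ℂ)).toAlgebra
  refine mem_of_perm_invariant (fun t => pullbackFun (powProj n X t))
    (constants ((pow n).obj X)).range P ?_ (fun q => hC _) h ?_
    (fun σ => pullbackFun ((reindex σ).app X)) ?_ ?_ s (mem_invariants.1 hs)
  · rintro _ ⟨c, rfl⟩
    exact hC c
  · exact pow_eq_top _ (fun c => Subring.subset_closure (Or.inl ⟨c, rfl⟩)) fun j f =>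
      Subring.subset_closure (Or.inr (Set.mem_iUnion.2 ⟨j, f, rfl⟩))
  · rintro σ _ ⟨c, rfl⟩
    exact pullbackFun_constants _ c
  · intro σ t a
    rw [← pullbackFun_comp, reindex_powProj]

theorem sum_mem_invariants (n : ℕ) (f : Γ(X.obj.left, ⊤)) :
    ∑ t, pullbackFun (powProj n X t) f ∈ invariants n X := by
  refine mem_invariants.2 fun σ => ?_
  rw [map_sum]
  simp_rw [← pullbackFun_comp, reindex_powProj]
  exact Equiv.sum_comp σ fun t => pullbackFun (powProj n X t) f

theorem pullbackFun_reindex_sum (i : Fin r) (f : Γ(X.obj.left, ⊤)) :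
    pullbackFun ((reindex fun t => (finSigmaFinEquiv (n := fun j => m j i)).symm t |>.1).app X)
      (∑ t, pullbackFun (powProj _ X t) f) =
      ∑ j, (m j i : Γ(((pow k).obj X).left, ⊤)) * pullbackFun (powProj k X j) f := by
  rw [map_sum]
  simp_rw [← pullbackFun_comp, reindex_powProj]
  exact sum_finSigmaFinEquiv (fun j => m j i) fun j => pullbackFun (powProj k X j) f

/-- The functions on `X^k` that extend to the incidence stratum. -/
theorem range_incidenceMap :
    (pullbackFun ((incidenceMap m).app X)).range = natWeightedRing m X := by
  refine le_antisymm ?_ ?_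
  · have htop : (natWeightedRing m X).comap (pullbackFun ((incidenceMap m).app X)) = ⊤ := by
      refine eq_top_of_pullbacks_mem (Z := fun i => (sym (∑ j, m j i)).obj X)
        (fun i => isAffine_sym X _) (fun i => symProj X i)
        (fun _ g => ⟨Limits.Pi.lift g, fun b => Limits.Pi.lift_π _ _⟩)
        (fun _ _ h => Limits.Pi.hom_ext _ _ h)
        ((natWeightedRing m X).comap (pullbackFun ((incidenceMap m).app X))) (fun c => ?_)
        fun i s => ?_
      · rw [Subring.mem_comap]
        have := pullbackFun_constants ((incidenceMap m).app X) c
        exact this ▸ constants_mem_natWeightedRing m X c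
      · change pullbackFun ((incidenceMap m).app X) (pullbackFun (symProj X i) s) ∈
          natWeightedRing m X
        rw [← pullbackFun_comp, incidenceMap_symProj, pullbackFun_comp]
        have hs : pullbackFun ((symQuot (∑ j, m j i)).app X) s ∈ invariants (∑ j, m j i) X := by
          rw [← range_symQuot]
          exact ⟨s, rfl⟩
        refine invariants_le X ((natWeightedRing m X).comap (pullbackFun ((reindex fun t =>
          (finSigmaFinEquiv (n := fun j => m j i)).symm t |>.1).app X))) (fun c => ?_)
          (fun f => ?_) hs
        · rw [Subring.mem_comap, pullbackFun_constants]
          exact constants_mem_natWeightedRing m X c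
        · rw [Subring.mem_comap, pullbackFun_reindex_sum]
          exact Subring.subset_closure (Or.inr ⟨(i, f), rfl⟩)
    rintro _ ⟨s, rfl⟩
    have : s ∈ (natWeightedRing m X).comap (pullbackFun ((incidenceMap m).app X)) :=
      htop ▸ trivial
    exact this
  · refine Subring.closure_le.2 ?_
    rintro _ (⟨c, rfl⟩ | ⟨⟨i, f⟩, rfl⟩)
    · exact ⟨_, pullbackFun_constants _ c⟩
    · have h := sum_mem_invariants X (∑ j, m j i) f
      rw [← range_symQuot] at h
      obtain ⟨s, hs⟩ := h
      refine ⟨pullbackFun (symProj X i) s, ?_⟩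
      rw [← pullbackFun_comp, incidenceMap_symProj, pullbackFun_comp, hs,
        pullbackFun_reindex_sum]

end Stratum

/-! ### Fibers of the family -/

section Fiber

/-- The projection `Y ×_T S → Y`. -/
def overFst {S T : Scheme.{0}} (g : S ⟶ T) (Y : Over T) : ((Over.pullback g).obj Y).left ⟶ Y.left :=
  pullback.fst Y.hom g

theorem overFst_condition {S T : Scheme.{0}} (g : S ⟶ T) (Y : Over T) :
    overFst g Y ≫ Y.hom = ((Over.pullback g).obj Y).hom ≫ g :=
  pullback.condition

theorem overFst_hom_ext {S T : Scheme.{0}} {g : S ⟶ T} {Y : Over T} {V : Scheme.{0}}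
    {u v : V ⟶ ((Over.pullback g).obj Y).left} (h : u ≫ overFst g Y = v ≫ overFst g Y)
    (h' : u ≫ ((Over.pullback g).obj Y).hom = v ≫ ((Over.pullback g).obj Y).hom) : u = v :=
  pullback.hom_ext h h'

theorem map_left_overFst {S T : Scheme.{0}} (g : S ⟶ T) {Y Z : Over T} (φ : Y ⟶ Z) :
    ((Over.pullback g).map φ).left ≫ overFst g Z = overFst g Y ≫ φ.left :=
  pullback.lift_fst _ _ _

variable (k r) in
/-- The projection `((ℂ^r)^k)° × X^k → X^k`. -/
def weightedPowFst : ((weightedPow k r).obj X).left ⟶ ((pow k).obj X).left :=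
  overFst (weightSpace k r).hom ((pow k).obj X)

theorem weightedPowFst_condition : weightedPowFst k r X ≫ ((pow k).obj X).hom =
    ((weightedPow k r).obj X).hom ≫ (weightSpace k r).hom :=
  overFst_condition _ _

variable {X} in
theorem weightedPowFst_hom_ext {V : Scheme.{0}} {u v : V ⟶ ((weightedPow k r).obj X).left}
    (h : u ≫ weightedPowFst k r X = v ≫ weightedPowFst k r X)
    (h' : u ≫ ((weightedPow k r).obj X).hom = v ≫ ((weightedPow k r).obj X).hom) : u = v :=
  overFst_hom_ext h h'

variable {X} in
theorem map_left_weightedPowFst {Y : AffVar} (φ : X ⟶ Y) :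
    ((weightedPow k r).map φ).left ≫ weightedPowFst k r Y =
      weightedPowFst k r X ≫ ((pow k).map φ).left :=
  map_left_overFst _ _

variable (w : Fin k → Fin r → ℂ) (hw : ∀ S : Finset (Fin k), S.Nonempty → ∑ j ∈ S, w j ≠ 0)

theorem toFiber_fst_fst : (toFiber w hw X).left ≫ overFst (weightPoint w hw) _ ≫
    weightedPowFst k r X = 𝟙 _ := by
  refine (pullback.lift_fst_assoc _ _ _ _).trans (pullback.lift_fst _ _ _)

theorem toFiber_fst_snd : (toFiber w hw X).left ≫ overFst (weightPoint w hw) _ ≫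
    ((weightedPow k r).obj X).hom = ((pow k).obj X).hom ≫ weightPoint w hw := by
  refine (pullback.lift_fst_assoc _ _ _ _).trans (pullback.lift_snd _ _ _)

variable {X w hw} in
/-- A morphism to the fiber of `((ℂ^r)^k)° × X^k` at `w` is determined by its component in `X^k`. -/
theorem fiber_hom_ext {T : Scheme.{0}}
    {u v : T ⟶ ((Over.pullback (weightPoint w hw)).obj ((weightedPow k r).obj X)).left}
    (h : u ≫ overFst (weightPoint w hw) _ ≫ weightedPowFst k r X =
      v ≫ overFst (weightPoint w hw) _ ≫ weightedPowFst k r X) : u = v := by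
  have h1 := overFst_condition (weightPoint w hw) ((weightedPow k r).obj X)
  have h2 : overFst (weightPoint w hw) _ ≫ weightedPowFst k r X ≫ ((pow k).obj X).hom =
      ((Over.pullback (weightPoint w hw)).obj ((weightedPow k r).obj X)).hom := by
    rw [weightedPowFst_condition, reassoc_of% h1]
    exact (congrArg (_ ≫ ·) (weightPoint_hom w hw)).trans (Category.comp_id _)
  have h4 : u ≫ ((Over.pullback (weightPoint w hw)).obj ((weightedPow k r).obj X)).hom =
      v ≫ ((Over.pullback (weightPoint w hw)).obj ((weightedPow k r).obj X)).hom := by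
    rw [← h2, reassoc_of% h]
  refine overFst_hom_ext (weightedPowFst_hom_ext ?_ ?_) h4
  · rw [Category.assoc, Category.assoc, h]
  · rw [Category.assoc, Category.assoc, h1, reassoc_of% h4]

theorem surjective_toFiber : Surjective (toFiber w hw X).left := by
  have : IsIso (toFiber w hw X).left :=
    ⟨overFst (weightPoint w hw) _ ≫ weightedPowFst k r X, toFiber_fst_fst X w hw,
      fiber_hom_ext (by
        rw [Category.assoc, toFiber_fst_fst, Category.comp_id, Category.id_comp])⟩
  infer_instance

variable {X} in
theorem toFiber_naturality {Y : AffVar} (φ : X ⟶ Y) :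
    (pow k).map φ ≫ toFiber w hw Y =
      toFiber w hw X ≫ (Over.pullback (weightPoint w hw)).map ((weightedPow k r).map φ) := by
  ext1
  refine fiber_hom_ext ?_
  have h3 := toFiber_fst_fst X w hw
  have h4 : (toFiber w hw X).left ≫ overFst (weightPoint w hw) _ ≫ weightedPowFst k r X ≫
      ((pow k).map φ).left = ((pow k).map φ).left := by
    rw [reassoc_of% h3]
  rw [Over.comp_left, Over.comp_left, Category.assoc, Category.assoc, toFiber_fst_fst,
    reassoc_of% (map_left_overFst (weightPoint w hw) ((weightedPow k r).map φ)),
    map_left_weightedPowFst, h4, Category.comp_id]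

/-- The morphism from `X^k` to the fiber of `Δ^{k,r}(X)` at `w` induced by `familyQuot`. -/
def fiberQuot : pow k ⟶ family k r ⋙ Over.pullback (weightPoint w hw) where
  app X := toFiber w hw X ≫ (Over.pullback (weightPoint w hw)).map ((familyQuot k r).app X)
  naturality X Y φ := by
    rw [← Category.assoc, toFiber_naturality, Category.assoc, Category.assoc]
    change _ ≫ _ = _ ≫ _ ≫ (Over.pullback (weightPoint w hw)).map ((family k r).map φ)
    rw [← CategoryTheory.Functor.map_comp, ← CategoryTheory.Functor.map_comp,
      (familyQuot k r).naturality]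

theorem surjective_fiberQuot : Surjective ((fiberQuot w hw).app X).left := by
  have h1 := surjective_toFiber X w hw
  have h2 : Surjective ((Over.pullback (weightPoint w hw)).map ((familyQuot k r).app X)).left :=
    MorphismProperty.of_isPullback (isPullback_overPullback_map _ _) (surjective_familyQuot k r X)
  change Surjective (_ ≫ _)
  infer_instance

theorem isAffine_fiber :
    IsAffine ((Over.pullback (weightPoint w hw)).obj ((family k r).obj X)).left := by
  have h := isAffineHom_pullback_snd _ (weightPoint w hw) (isAffineHom_family k r X)
  exact isAffine_of_isAffineHom (pullback.snd ((family k r).obj X).hom (weightPoint w hw))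

theorem isClosedImmersion_affinePoint : IsClosedImmersion (affinePoint w) :=
  IsClosedImmersion.spec_of_surjective _ fun c => ⟨MvPolynomial.C c, by simp⟩

theorem affinePoint_hom : affinePoint w ≫ (affineWeightSpace k r).hom = 𝟙 _ := by
  change Spec.map _ ≫ Spec.map _ = _
  rw [← Spec.map_comp, ← CommRingCat.ofHom_comp, ← Spec.map_id, ← CommRingCat.ofHom_id]
  congr 2
  ext c
  simp

variable (k r) in
/-- The inclusion of the space of weights into `Spec ℂ[m_{j,i}]`. -/
def weightSpaceι : (weightSpace k r).left ⟶ Spec (weightRing k r) :=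
  show (weightOpen k r).toScheme ⟶ _ from (weightOpen k r).ι

theorem weightPoint_weightSpaceι : weightPoint w hw ≫ weightSpaceι k r = affinePoint w :=
  IsOpenImmersion.lift_fac (weightOpen k r).ι _ _

variable (k r) in
/-- The inclusion of `Δ^{k,r}(X)` into `Spec R(X)`. -/
def familyFst : ((family k r).obj X).left ⟶ ((affineFamily k r).obj X).left :=
  overFst (weightOpen k r).ι _

theorem isPullback_familyFst : IsPullback (familyFst k r X) ((family k r).obj X).hom
    ((affineFamily k r).obj X).hom (weightSpaceι k r) :=
  IsPullback.of_hasPullback _ _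

/-- The inclusion of the fiber of `Δ^{k,r}(X)` at `w` into `Spec R(X)`. -/
def fiberι : ((Over.pullback (weightPoint w hw)).obj ((family k r).obj X)).left ⟶
    ((affineFamily k r).obj X).left :=
  overFst (weightPoint w hw) _ ≫ familyFst k r X

theorem isClosedImmersion_fiberι : IsClosedImmersion (fiberι X w hw) := by
  have h1 : IsPullback (overFst (weightPoint w hw) ((family k r).obj X))
      ((Over.pullback (weightPoint w hw)).obj ((family k r).obj X)).hom
      ((family k r).obj X).hom (weightPoint w hw) := IsPullback.of_hasPullback _ _
  have h2 := h1.paste_horiz (isPullback_familyFst X)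
  rw [weightPoint_weightSpaceι] at h2
  exact MorphismProperty.of_isPullback h2.flip (isClosedImmersion_affinePoint w)

/-- The morphism `x ↦ (x, w)` from `X^k` to `X^k × Spec ℂ[m_{j,i}]`. -/
def slice : ((pow k).obj X).left ⟶ ((affineWeightedPow k r).obj X).left :=
  pullback.lift (𝟙 _) (((pow k).obj X).hom ≫ affinePoint w) (by
    rw [Category.assoc, Category.id_comp, affinePoint_hom]
    exact (Category.comp_id _).symm)

theorem slice_powFst : slice X w ≫ powFst k r X = 𝟙 _ := pullback.lift_fst _ _ _

theorem slice_hom : slice X w ≫ ((affineWeightedPow k r).obj X).hom =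
    ((pow k).obj X).hom ≫ affinePoint w := pullback.lift_snd _ _ _

variable (k r) in
/-- The inclusion `τ` of `((ℂ^r)^k)° × X^k` into `X^k × Spec ℂ[m_{j,i}]` is compatible with the
quotient morphisms. -/
theorem exists_familyQuot_familyFst : ∃ τ : ((weightedPow k r).obj X).left ⟶
      ((affineWeightedPow k r).obj X).left,
    ((familyQuot k r).app X).left ≫ familyFst k r X = τ ≫ ((affineQuot k r).app X).left ∧
    τ ≫ powFst k r X = weightedPowFst k r X ∧
    τ ≫ ((affineWeightedPow k r).obj X).hom =
      ((weightedPow k r).obj X).hom ≫ weightSpaceι k r := by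
  let i : ((weightedPow k r).obj X).left ⟶
      ((Over.pullback (weightOpen k r).ι).obj ((affineWeightedPow k r).obj X)).left :=
    (pullbackLeftPullbackSndIso ((pow k).obj X).hom (affineWeightSpace k r).hom
      (weightOpen k r).ι).inv
  refine ⟨i ≫ overFst (weightOpen k r).ι _, ?_, ?_, ?_⟩
  · have h : ((familyQuot k r).app X).left =
        i ≫ ((Over.pullback (weightOpen k r).ι).map ((affineQuot k r).app X)).left := rfl
    rw [h, Category.assoc, ← map_left_overFst]
    exact Category.assoc _ _ _
  · exact (Category.assoc _ _ _).trans (pullbackLeftPullbackSndIso_inv_fst _ _ _)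
  · exact (Category.assoc _ _ _).trans (pullbackLeftPullbackSndIso_inv_fst_snd _ _ _)

theorem fiberQuot_fiberι : ((fiberQuot w hw).app X).left ≫ fiberι X w hw =
    slice X w ≫ ((affineQuot k r).app X).left := by
  obtain ⟨τ, h1, h2, h3⟩ := exists_familyQuot_familyFst k r X
  have h4 : (toFiber w hw X).left ≫ overFst (weightPoint w hw) _ ≫ τ = slice X w := by
    refine pullback.hom_ext ?_ ?_
    · change _ ≫ powFst k r X = _ ≫ powFst k r X
      rw [Category.assoc, Category.assoc, h2, toFiber_fst_fst, slice_powFst]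
    · change _ ≫ ((affineWeightedPow k r).obj X).hom = _ ≫ ((affineWeightedPow k r).obj X).hom
      rw [Category.assoc, Category.assoc, h3, slice_hom, ← weightPoint_weightSpaceι w hw]
      have h5 := toFiber_fst_snd X w hw
      rw [reassoc_of% h5]
  change ((toFiber w hw X).left ≫
    ((Over.pullback (weightPoint w hw)).map ((familyQuot k r).app X)).left) ≫ overFst _ _ ≫ _ = _
  rw [Category.assoc, reassoc_of% (map_left_overFst (weightPoint w hw) ((familyQuot k r).app X)),
    h1, ← h4, Category.assoc, Category.assoc]

theorem slice_coordFun (j : Fin k) (f : Γ(X.obj.left, ⊤)) :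
    (slice X w).appTop.hom (coordFun k r X j f) = pullbackFun (powProj k X j) f := by
  change (slice X w).appTop.hom ((powFst k r X).appTop.hom _) = _
  rw [← comp_appTop_apply, slice_powFst]
  simp

theorem slice_scalars (c : weightRing k r) :
    (slice X w).appTop.hom (scalars ((affineWeightedPow k r).obj X) c) =
      constants ((pow k).obj X) (MvPolynomial.eval (fun q => w q.1 q.2) c) := by
  change (slice X w).appTop.hom (((affineWeightedPow k r).obj X).hom.appTop.hom _) = _
  rw [← comp_appTop_apply, slice_hom, comp_appTop_apply]
  have h : CommRingCat.ofHom (MvPolynomial.eval fun q : Fin k × Fin r => w q.1 q.2) ≫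
      (Scheme.ΓSpecIso (CommRingCat.of ℂ)).inv = (Scheme.ΓSpecIso (weightRing k r)).inv ≫
        (affinePoint w).appTop :=
    Scheme.ΓSpecIso_inv_naturality _
  exact congrArg (fun u => (u ≫ ((pow k).obj X).hom.appTop).hom c) h.symm

variable (hm : ∀ S : Finset (Fin k), S.Nonempty → ∑ j ∈ S, (fun i => (m j i : ℂ)) ≠ 0)

/-- The functions on `X^k` that extend to the fiber of the family. As the fiber is closed in
`Spec R(X)`, they are the restrictions of the functions in `R(X)` to constant weights `m`. -/
theorem range_fiberQuot :
    (pullbackFun ((fiberQuot (fun j i => (m j i : ℂ)) hm).app X)).range =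
      natWeightedRing m X := by
  have := isAffine_fiber X _ hm
  have : IsAffine ((affineFamily k r).obj X).left := isAffine_spectrum _ _ _
  have := isClosedImmersion_fiberι X _ hm
  rw [pullbackFun, range_appTop_of_comp_eq (fiberQuot_fiberι X _ hm)
    (IsClosedImmersion.isAffine_surjective_of_isAffine (fiberι X _ hm)).2,
    Scheme.Hom.comp_appTop, CommRingCat.hom_comp, ← RingHom.map_range]
  have h : ((affineQuot k r).app X).left.appTop.hom.range = weightedRing k r X :=
    range_toSpectrum _ _ _
  rw [h, weightedRing, RingHom.map_closure, natWeightedRing, Set.image_union]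
  congr 2
  · ext s
    constructor
    · rintro ⟨_, ⟨c, rfl⟩, rfl⟩
      exact ⟨_, (slice_scalars X _ c).symm⟩
    · rintro ⟨c, rfl⟩
      exact ⟨_, ⟨MvPolynomial.C c, rfl⟩, by rw [slice_scalars, MvPolynomial.eval_C]⟩
  · rw [weightedSums, ← Set.range_comp]
    congr 1
    funext ⟨i, f⟩
    simp only [Function.comp, map_sum, map_mul, slice_coordFun]
    refine Finset.sum_congr rfl fun j _ => congrArg (· * _) ?_
    rw [slice_scalars, MvPolynomial.eval_X, map_natCast]

theorem toReduction_naturality {S : Scheme.{0}} {Y Y' Z Z' : Over S} (hY : IsReduced Y.left)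
    (hY' : IsReduced Y'.left) {f : Y ⟶ Z} {f' : Y' ⟶ Z'} {a : Y ⟶ Y'} {b : Z ⟶ Z'}
    (h : a ≫ f' = f ≫ b) :
    a ≫ toReduction hY' f' = toReduction hY f ≫ (reduction S).map b := by
  rw [← cancel_mono (reductionι _), Category.assoc, toReduction_reductionι, h,
    Category.assoc, reduction_map_reductionι, ← Category.assoc, toReduction_reductionι]

/-- The reduced fiber at `m` and the incidence stratum are both images of `X^k`, and the same
functions on `X^k` extend to them. -/
theorem exists_iso_stratum :
    ∃ e : family k r ⋙ reducedFiber (weightPoint (fun j i => (m j i : ℂ)) hm) ≅ stratum m,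
      ∀ X : AffVar, (toStratum m).app X ≫ e.inv.app X ≫
          reductionι ((Over.pullback (weightPoint _ hm)).obj ((family k r).obj X)) =
        (fiberQuot _ hm).app X := by
  let t : pow k ⟶ family k r ⋙ reducedFiber (weightPoint (fun j i => (m j i : ℂ)) hm) :=
    { app := fun X => toReduction (isReduced_pow k X) ((fiberQuot _ hm).app X)
      naturality := fun X Y φ => toReduction_naturality (isReduced_pow k X) (isReduced_pow k Y)
        ((fiberQuot _ hm).naturality φ) }
  have ht : ∀ X, (t.app X).left.appTop.hom.range = natWeightedRing m X := fun X =>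
    (range_toReduction (isReduced_pow k X) ((fiberQuot _ hm).app X) (isAffine_fiber X _ hm)).trans
      (range_fiberQuot m X hm)
  have ht' : ∀ X, ((toStratum m).app X).left.appTop.hom.range = natWeightedRing m X := fun X =>
    (range_toImageFunctor (incidenceMap m) X (isAffine_symProd X _)).trans (range_incidenceMap m X)
  have hinj : ∀ X, Function.Injective (t.app X).left.appTop.hom := fun X =>
    toReduction_injective (isReduced_pow k X) ((fiberQuot _ hm).app X) (isAffine_fiber X _ hm)
      (surjective_fiberQuot X _ hm)
  have hinj' : ∀ X, Function.Injective ((toStratum m).app X).left.appTop.hom := fun X =>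
    toImageFunctor_injective (incidenceMap m) X (isAffine_pow k X) (isAffine_symProd X _)
  obtain ⟨e, he⟩ := exists_iso_of_range_eq t (toStratum m)
    (fun X => isAffine_reduction _ (isAffine_fiber X _ hm))
    (fun X => isAffine_imageFunctor (incidenceMap m) X (isAffine_symProd X _)) hinj hinj'
    fun X => (ht X).trans (ht' X).symm
  refine ⟨e, fun X => ?_⟩
  have h : (toStratum m).app X ≫ e.inv.app X = t.app X := by
    rw [← he, NatTrans.comp_app, Category.assoc, Iso.hom_inv_id_app, Category.comp_id]
  exact (Category.assoc _ _ _).symm.trans ((congrArg (· ≫ reductionι _) h).trans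
    (toReduction_reductionι (isReduced_pow k X) _))

end Fiber

end IncidenceStrata
end

/-- There are a functor `Δ` from affine varieties to varieties that are affine over the space of
weights `((ℂ^r)^k)°` and a natural finite surjective morphism `q : ((ℂ^r)^k)° × X^k → Δ(X)` such
that the reduced fiber of `Δ(X)` at nonzero weights `m_1, …, m_k ∈ ℕ^r` is the `r`-colored
incidence stratum, naturally in `X` and compatibly with the morphisms from `X^k`. -/
theorem theorem1p1 (k r : ℕ) (hr : 0 < r) :
    ∃ (Δ : AffVar ⥤ Over (weightSpace k r).left) (q : weightedPow k r ⟶ Δ),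
      (∀ X : AffVar,
        IsVariety ((Over.map (weightSpace k r).hom).obj (Δ.obj X)) ∧
        IsAffineHom (Δ.obj X).hom ∧
        (r = 1 → IsAffine (Δ.obj X).left) ∧
        (IrreducibleSpace X.obj.left → IrreducibleSpace (Δ.obj X).left) ∧
        IsFinite (q.app X).left ∧
        Surjective (q.app X).left) ∧
      ∀ (m : Fin k → Fin r → ℕ) (hm : ∀ j, m j ≠ 0),
        ∃ e : Δ ⋙ reducedFiber (natPoint m hm) ≅ stratum m,
          ∀ X : AffVar,
            (toStratum m).app X ≫ e.inv.app X ≫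
                reductionι ((Over.pullback (natPoint m hm)).obj (Δ.obj X)) =
              toFiber (fun j i => (m j i : ℂ)) (natWeights_sum_ne_zero m hm) X ≫
                (Over.pullback (natPoint m hm)).map (q.app X) :=
  ⟨family k r, familyQuot k r,
    fun X => ⟨isVariety_family k r X, isAffineHom_family k r X,
      fun h => by subst h; exact isAffine_family k X,
      fun _ => irreducibleSpace_family k r X hr, isFinite_familyQuot k r X,
      surjective_familyQuot k r X⟩,
    fun m hm => exists_iso_stratum m (natWeights_sum_ne_zero m hm)⟩
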